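/- Let $M$ be a smooth 3-manifold (possibly with boundary and corners) with a smooth Riemannian metric $g$, let $f>0$ be a smooth function on $M$, let $\lambda\in[0,1]$, and put $g'=f^4g$, $g_\lambda=f^{4\lambda}g$. For a metric written in coordinates as $(g_{ij})$ put $\mu_g=\sum_{i,j}(\partial_i g_{ij}-\partial_j g_{ii})\,dx^j$. (a) Let $M_{end}\subset M$ be open with a diffeomorphism $x:M_{end}\to\mathbb{R}^3\setminus \overline{B}_1$ in which $|\partial^l(g_{ij}-\delta_{ij})|=O(|x|^{-q-l})$ for $l=0,1,2$ and some $q\in(\tfrac12,1)$, and assume that the scalar curvature $R_g$ is integrable on $(M_{end},g)$. Suppose that, with $r=|x|$, $|f-1|+r|\nabla^g f|_g=O(r^{-q'})$ as $r\to\infty$ for some $q'\in(\tfrac12,1)$, and that $\Delta_g f$ is integrable on $(M_{end},g)$. Then the ADM masses in these coordinates, $$m(h)=\lim_{\rho\to\infty}\frac1{16\pi}\int_{S_\rho}\mu_h[n^0]\,d\sigma^0_\rho ,$$ where $S_\rho=\{|x|=\rho\}$ and $n^0$, $d\sigma^0_\rho$ are its Euclidean outer unit normal and area element, exist (as real numbers)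 for $h=g,g',g_\lambda$, and $$m(g_\lambda)=(1-\lambda)\,m(g)+\lambda\, m(g').$$ (b) Let $M_{end}\subset M$ be open with a diffeomorphism $y:M_{end}\to\{y_3\ge0,\ |y|>1\}\subset\mathbb{R}^3$ with respect to which both $g$ and $g'$ are asymptotically flat half-space metrics; that is, for $h=g$ and for $h=g'$, $|\partial^l(h_{ij}-\delta_{ij})|=O(|y|^{-q-l})$ for $l=0,1,2$ and some $q\in(\tfrac12,1)$ (depending on $h$), the scalar curvature of $h$ is integrable on $(M_{end},h)$, and the mean curvature of $\Sigma=\{y_3=0\}$ with respect to $h$ is integrable on $\Sigma$ for the area induced by $h$. Then the half-space masses $$m_\Sigma(h)=\lim_{\rho\to\infty}\frac1{16\pi}\Big(\int_{S^+_\rho}\mu_h[\mu^0]\,d\sigma^0_\rho+\int_{\partial S^+_\rho}\langle\partial_{y_3},\theta^0\rangle_h\,ds^0_\rho\Big),$$ where $S^+_\rho=\{|y|=\rho,\ y_3\ge0\}$, $\mu^0$ is its Euclidean outer unit normal, $\theta^0$ is the Euclidean outer unit conormal of the circle $\partial S^+_\rho$ in $\Sigma$, and $d\sigma^0_\rho$,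 $ds^0_\rho$ are the Euclidean area and length elements, exist (as real numbers) for $h=g,g',g_\lambda$, and $$m_\Sigma(g_\lambda)=(1-\lambda)\,m_\Sigma(g)+\lambda\, m_\Sigma(g').$$ -/

import Mathlib

open Bundle Filter MeasureTheory Asymptotics
open scoped Manifold ContDiff Topology

noncomputable section

namespace ConformalMass

/-- Euclidean three-space. -/
abbrev E3 : Type := EuclideanSpace ℝ (Fin 3)

/-- The Euclidean plane. -/
abbrev E2 : Type := EuclideanSpace ℝ (Fin 2)

/-- The complement of the closed unit ball in `ℝ³`. -/
def exterior : Set E3 := {x | 1 < ‖x‖}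

/-- The complement of the closed unit half-ball in the closed half-space `x₃ ≥ 0` of `ℝ³`
(the third coordinate has index `2`). -/
def halfExterior : Set E3 := {x | 0 ≤ x 2 ∧ 1 < ‖x‖}

/-- The point `(z₁, z₂, 0)` of the plane `x₃ = 0`. -/
def inPlane (z : E2) : E3 := !₂[z 0, z 1, 0]

section Coordinates

/-! ### Tensor calculus in a coordinate region

`U ⊆ ℝ³` is the coordinate region and `G x` is the matrix `(g_ij(x))` of a metric at `x ∈ U`.
Derivatives are taken within `U`, so that they are one-sided at boundary points of `U`. -/

variable (U : Set E3)

/-- The partial derivative `∂_i h` on `U`. -/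
def pd (i : Fin 3) (h : E3 → ℝ) (x : E3) : ℝ :=
  fderivWithin ℝ h U x (EuclideanSpace.single i 1)

/-- The filter of neighbourhoods of infinity in `U`. -/
def atInfinity : Filter E3 := Bornology.cobounded E3 ⊓ 𝓟 U

/-- `|∂^l (g_ij - δ_ij)| = O(|x|^(-q-l))` for `l = 0, 1, 2` and some `1/2 < q < 1`. -/
def DecaysToEuclidean (G : E3 → Matrix (Fin 3) (Fin 3) ℝ) : Prop :=
  ∃ q : ℝ, 1 / 2 < q ∧ q < 1 ∧ ∀ i j : Fin 3,
    ((fun x => G x i j - (1 : Matrix (Fin 3) (Fin 3) ℝ) i j)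
      =O[atInfinity U] fun x => ‖x‖ ^ (-q)) ∧
    (∀ k, pd U k (fun x => G x i j) =O[atInfinity U] fun x => ‖x‖ ^ (-q - 1)) ∧
    (∀ k l, pd U l (pd U k (fun x => G x i j)) =O[atInfinity U] fun x => ‖x‖ ^ (-q - 2))

/-- Christoffel symbols `Γ^k_ij = ½ ∑_l g^kl (∂_i g_jl + ∂_j g_il - ∂_l g_ij)`. -/
def christoffel (G : E3 → Matrix (Fin 3) (Fin 3) ℝ) (k i j : Fin 3) (x : E3) : ℝ :=
  1 / 2 * ∑ l, (G x)⁻¹ k l *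
    (pd U i (fun y => G y j l) x + pd U j (fun y => G y i l) x - pd U l (fun y => G y i j) x)

/-- Ricci curvature
`R_ij = ∑_k (∂_k Γ^k_ij - ∂_j Γ^k_ik) + ∑_{k,l} (Γ^k_kl Γ^l_ij - Γ^k_jl Γ^l_ik)`. -/
def ricci (G : E3 → Matrix (Fin 3) (Fin 3) ℝ) (i j : Fin 3) (x : E3) : ℝ :=
  ∑ k, (pd U k (christoffel U G k i j) x - pd U j (christoffel U G k i k) x)
    + ∑ k, ∑ l, (christoffel U G k k l x * christoffel U G l i j x
        - christoffel U G k j l x * christoffel U G l i k x)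

/-- Scalar curvature `∑_{i,j} g^ij R_ij`. -/
def scalarCurvature (G : E3 → Matrix (Fin 3) (Fin 3) ℝ) (x : E3) : ℝ :=
  ∑ i, ∑ j, (G x)⁻¹ i j * ricci U G i j x

/-- The density `√det(g_ij)` of the Riemannian volume with respect to Lebesgue measure. -/
def volumeDensity (G : E3 → Matrix (Fin 3) (Fin 3) ℝ) (x : E3) : ℝ := √(G x).det

/-- `h` is integrable on `U` for the Riemannian volume of `g`. -/
def IntegrableForVolume (G : E3 → Matrix (Fin 3) (Fin 3) ℝ) (h : E3 → ℝ) : Prop :=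
  IntegrableOn (fun x => h x * volumeDensity G x) U volume

/-- `|∇^g h|_g = (∑_{i,j} g^ij ∂_i h ∂_j h)^(1/2)`. -/
def gradientNorm (G : E3 → Matrix (Fin 3) (Fin 3) ℝ) (h : E3 → ℝ) (x : E3) : ℝ :=
  √(∑ i, ∑ j, (G x)⁻¹ i j * pd U i h x * pd U j h x)

/-- The Laplace-Beltrami operator
`Δ_g h = (det g)^(-1/2) ∑_{i,j} ∂_i ((det g)^(1/2) g^ij ∂_j h)`. -/
def laplacian (G : E3 → Matrix (Fin 3) (Fin 3) ℝ) (h : E3 → ℝ) (x : E3) : ℝ :=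
  (volumeDensity G x)⁻¹ *
    ∑ i, pd U i (fun y => ∑ j, volumeDensity G y * (G y)⁻¹ i j * pd U j h y) x

/-- The metric induced on the plane `x₃ = 0`. -/
def inducedMetric (G : E3 → Matrix (Fin 3) (Fin 3) ℝ) (z : E2) : Matrix (Fin 2) (Fin 2) ℝ :=
  (G (inPlane z)).submatrix Fin.castSucc Fin.castSucc

/-- Mean curvature of the boundary `x₃ = 0` of the region `x₃ ≥ 0`, at the point `(z, 0)`: the
trace, for the induced metric, of the second fundamental form `A(X, Y) = g(∇_X n, Y)` of the
outward unit normal `n`. As the one-form dual to `n` is `-(g^33)^(-1/2) dx₃`, the components of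
`A` are `-g(n, ∇_α ∂_β) = (g^33)^(-1/2) Γ^3_αβ`. -/
def meanCurvature (G : E3 → Matrix (Fin 3) (Fin 3) ℝ) (z : E2) : ℝ :=
  ∑ α : Fin 2, ∑ β : Fin 2, (inducedMetric G z)⁻¹ α β *
    (christoffel U G 2 α.castSucc β.castSucc (inPlane z) / √((G (inPlane z))⁻¹ 2 2))

/-- `h` is integrable on the part `|z| > 1` of the plane `x₃ = 0` for the Riemannian area. -/
def IntegrableForArea (G : E3 → Matrix (Fin 3) (Fin 3) ℝ) (h : E2 → ℝ) : Prop :=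
  IntegrableOn (fun z => h z * √(inducedMetric G z).det) {z : E2 | 1 < ‖z‖} volume

/-- The components `∑_i (∂_i g_ij - ∂_j g_ii)` of the mass one-form `μ_g`. -/
def massForm (G : E3 → Matrix (Fin 3) (Fin 3) ℝ) (j : Fin 3) (x : E3) : ℝ :=
  ∑ i, (pd U i (fun y => G y i j) x - pd U j (fun y => G y i i) x)

/-- The integral of `μ_g[n⁰]` over `S_ρ ∩ U` for the Euclidean area, where `S_ρ` is the
coordinate sphere of radius `ρ` and `n⁰ = x / ρ`; the integral is written as `ρ²` times an
integral over the unit sphere. For `ρ > 1`, the set `S_ρ ∩ U` is the full sphere if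
`U = exterior` and the upper hemisphere if `U = halfExterior`. -/
def massFlux (G : E3 → Matrix (Fin 3) (Fin 3) ℝ) (ρ : ℝ) : ℝ :=
  ρ ^ 2 * ∫ v in {v : Metric.sphere (0 : E3) 1 | ρ • (v : E3) ∈ U},
    (∑ j, massForm U G j (ρ • (v : E3)) * (v : E3) j) ∂(volume : Measure E3).toSphere

/-- The integral of `⟨∂_{x₃}, θ⁰⟩_g` over the circle of radius `ρ` in the plane `x₃ = 0` for
the Euclidean length, where `θ⁰ = (z, 0) / ρ` is the outer unit conormal; it is written as `ρ`
times an integral over the unit circle. -/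
def circleTerm (G : E3 → Matrix (Fin 3) (Fin 3) ℝ) (ρ : ℝ) : ℝ :=
  ρ * ∫ v : Metric.sphere (0 : E2) 1,
    (∑ j, G (inPlane (ρ • (v : E2))) 2 j * inPlane (v : E2) j) ∂(volume : Measure E2).toSphere

end Coordinates

section Manifold

variable {H : Type*} [TopologicalSpace H] (I : ModelWithCorners ℝ E3 H)
  (M : Type*) [TopologicalSpace M] [ChartedSpace H M]

/-- An end of `M` with coordinate region `U`: an open subset of `M` (the end) together with a
diffeomorphism onto `U ⊆ ℝ³`. -/
structure EndChart (U : Set E3) where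
  /-- the end, as a subset of `M` -/
  source : Set M
  isOpen_source : IsOpen source
  /-- the coordinates on the end -/
  toFun : M → E3
  /-- the inverse of the coordinate map -/
  invFun : E3 → M
  mapsTo : Set.MapsTo toFun source U
  mapsTo_inv : Set.MapsTo invFun U source
  left_inv : Set.LeftInvOn invFun toFun source
  right_inv : Set.RightInvOn invFun toFun U
  contMDiffOn : ContMDiffOn I 𝓘(ℝ, E3) ∞ toFun source
  contMDiffOn_inv : ContMDiffOn 𝓘(ℝ, E3) I ∞ invFun U

/-- Smooth Riemannian metrics on `M`. -/
abbrev Metric3 [IsManifold I ∞ M] : Type _ :=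
  ContMDiffRiemannianMetric I ∞ E3 (fun p : M => TangentSpace I p)

variable {I M} [IsManifold I ∞ M]

/-- The conformal metric `f^s g`, for a positive smooth function `f` and a real exponent `s`. -/
def conformal (g : Metric3 I M) (f : M → ℝ) (hf : ContMDiff I 𝓘(ℝ, ℝ) ∞ f)
    (hpos : ∀ p, 0 < f p) (s : ℝ) : Metric3 I M where
  inner p := f p ^ s • g.inner p
  symm p v w := by
    simp only [_root_.smul_apply]
    rw [g.symm]
  pos p v hv := by
    simp only [_root_.smul_apply, smul_eq_mul]
    exact mul_pos (Real.rpow_pos_of_pos (hpos p) s) (g.pos p v hv)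
  isVonNBounded p := by
    have hc : 0 < f p ^ s := Real.rpow_pos_of_pos (hpos p) s
    have hr : 0 < √(f p ^ s) := Real.sqrt_pos.2 hc
    have hb := (g.isVonNBounded p).image
      ((√(f p ^ s))⁻¹ • ContinuousLinearMap.id ℝ (TangentSpace I p))
    refine hb.subset ?_
    intro v hv
    refine ⟨√(f p ^ s) • v, ?_, ?_⟩
    · simp only [Set.mem_ofPred_eq, _root_.smul_apply, smul_eq_mul, map_smul] at hv ⊢
      rw [← mul_assoc, Real.mul_self_sqrt hc.le]
      exact hv
    · simp [smul_smul, mul_inv_cancel₀ hr.ne']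
  contMDiff := by
    have h1 : ContMDiff I 𝓘(ℝ, ℝ) ∞ (fun p => f p ^ s) := by
      intro p
      have h2 : ContDiffAt ℝ ∞ (fun t : ℝ => t ^ s) (f p) :=
        Real.contDiffAt_rpow_const_of_ne (hpos p).ne'
      exact h2.contMDiffAt.comp p (hf p)
    exact ContMDiff.smul_section (F := E3 →L[ℝ] E3 →L[ℝ] ℝ)
      (V := fun p : M => TangentSpace I p →L[ℝ] TangentSpace I p →L[ℝ] ℝ)
      (f := fun p => f p ^ s) (s := g.inner) h1 g.contMDiff

/-- The matrix `(g_ij(x))` of a metric in the coordinates of an end. -/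
def coordMetric {U : Set E3} (e : EndChart I M U) (g : Metric3 I M) (x : E3) :
    Matrix (Fin 3) (Fin 3) ℝ :=
  Matrix.of fun i j => g.inner (e.invFun x)
    (mfderivWithin 𝓘(ℝ, E3) I e.invFun U x (EuclideanSpace.single i (1 : ℝ)))
    (mfderivWithin 𝓘(ℝ, E3) I e.invFun U x (EuclideanSpace.single j (1 : ℝ)))

/-- `g` is asymptotically flat, with integrable scalar curvature, in the end `e`. -/
def IsAsymptoticallyFlat (e : EndChart I M exterior) (g : Metric3 I M) : Prop :=
  DecaysToEuclidean exterior (coordMetric e g) ∧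
  IntegrableForVolume exterior (coordMetric e g) (scalarCurvature exterior (coordMetric e g))

/-- The asymptotic conditions on the conformal factor: `|f - 1| + r |∇^g f|_g = O(r^(-q))` for
some `1/2 < q < 1`, and `Δ_g f` is integrable. -/
def IsConformalFactor (e : EndChart I M exterior) (g : Metric3 I M) (f : M → ℝ) : Prop :=
  (∃ q : ℝ, 1 / 2 < q ∧ q < 1 ∧
    (fun x => |f (e.invFun x) - 1|
        + ‖x‖ * gradientNorm exterior (coordMetric e g) (f ∘ e.invFun) x)
      =O[atInfinity exterior] fun x => ‖x‖ ^ (-q)) ∧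
  IntegrableForVolume exterior (coordMetric e g)
    (laplacian exterior (coordMetric e g) (f ∘ e.invFun))

/-- `g` is an asymptotically flat half-space metric in the end `e`: the metric decays to the
Euclidean one and the scalar curvature and the mean curvature of the boundary are integrable. -/
def IsAsymptoticallyFlatHalfSpace (e : EndChart I M halfExterior) (g : Metric3 I M) : Prop :=
  DecaysToEuclidean halfExterior (coordMetric e g) ∧
  IntegrableForVolume halfExterior (coordMetric e g)
    (scalarCurvature halfExterior (coordMetric e g)) ∧
  IntegrableForArea (coordMetric e g) (meanCurvature halfExterior (coordMetric e g))

/-- The ADM mass of `g` in the end `e` exists and equals `m`. -/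
def HasADMMass (e : EndChart I M exterior) (g : Metric3 I M) (m : ℝ) : Prop :=
  Tendsto (fun ρ : ℝ => 1 / (16 * Real.pi) * massFlux exterior (coordMetric e g) ρ)
    atTop (𝓝 m)

/-- The half-space mass `m_Σ` of `g` in the end `e` exists and equals `m`. -/
def HasHalfSpaceMass (e : EndChart I M halfExterior) (g : Metric3 I M) (m : ℝ) : Prop :=
  Tendsto (fun ρ : ℝ => 1 / (16 * Real.pi) *
      (massFlux halfExterior (coordMetric e g) ρ + circleTerm (coordMetric e g) ρ))
    atTop (𝓝 m)

end Manifold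

end ConformalMass

end

/-! Everything rests on one expansion. Write `F` for the conformal factor in coordinates. Since `g`
and `F` approach `δ` and `1` at a common rate `q > 1/2`, the mass form of `F ^ s g` is `μ_g - 2 s dF
+ O(r^(-2q-1))`: contracting `s ∂F δ` gives `1 - 3 = -2` copies of `s dF`, and all other terms are
products of two decaying factors (`DecayingFactor.massForm_sub`). As `2q + 1 > 2`, the error has
vanishing flux through large spheres. So the flux for `F ^ s g` equals that for `g` minus `2 s N(ρ)`
up to `o(1)`, with `N(ρ)` the flux of `dF`. This is affine in `s`; putting `s = 4 t` gives the
interpolation once two of the quantities involved are known to converge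
(`tendsto_of_tendsto_sub_affine`).

Convergence comes from the divergence theorem. The linear part of the scalar curvature is exactly
the divergence of the mass form, so `div μ_g = R_g √det g + O(r^(-2q-2))`, which is integrable in
dimension three. On the half-space, the circle term is the flux in the boundary plane of `Y_α =
g_3α`, and `(μ_g)_3 + div Y` is twice the mean curvature density up to `O(r^(-2q-1))`, integrable in
dimension two. The circle term itself does not see the conformal factor in the limit, because `g_3α`
is off-diagonal and `(F ^ s - 1) g_3α = O(r^(-2q))` with `2q > 1`.

In part (a) the flux of `dF` converges because it is asymptotic to that of `√g ∇f`, whose divergence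
is the density of the integrable Laplacian. In part (b) the masses of both `g` and `f⁴ g` exist by
the curvature hypotheses, and the decay of `F` is recovered from the quotient of corresponding
components of the two metrics.

The divergence theorem is used only in weak form: the flux, as a function of the radius, is tested
against the derivative of a radial cutoff (`IsRegularCone.integral_deriv_mul_flux`). This requires
polar coordinates and the divergence theorem for compactly supported fields on the space or
half-space; `exists_tendsto_of_weak_bound` then yields the limit. -/

namespace ConformalMass

/-! ### Limits from weak bounds on the derivative -/

/-- A smooth step from `0` to `1` on the interval `[c, c + ε]`. -/
noncomputable def smoothStep (c ε r : ℝ) : ℝ := Real.smoothTransition ((r - c) / ε)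

theorem contDiff_smoothStep (c ε : ℝ) : ContDiff ℝ 1 (smoothStep c ε) := by
  unfold smoothStep
  exact (Real.smoothTransition.contDiff (n := 1)).comp (by fun_prop)

theorem smoothStep_mono {c ε : ℝ} (hε : 0 < ε) : Monotone (smoothStep c ε) := fun r s h =>
  Real.smoothTransition.monotone (by gcongr)

theorem smoothStep_of_le {c ε r : ℝ} (hε : 0 < ε) (h : r ≤ c) : smoothStep c ε r = 0 :=
  Real.smoothTransition.zero_of_nonpos (div_nonpos_of_nonpos_of_nonneg (by linarith) hε.le)

theorem smoothStep_of_ge {c ε r : ℝ} (hε : 0 < ε) (h : c + ε ≤ r) : smoothStep c ε r = 1 :=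
  Real.smoothTransition.one_of_one_le (by rw [le_div_iff₀ hε]; linarith)

theorem deriv_smoothStep_eq_zero {c ε r : ℝ} (hε : 0 < ε) (h : r ∉ Set.Icc c (c + ε)) :
    deriv (smoothStep c ε) r = 0 := by
  rw [Set.mem_Icc, not_and_or, not_le, not_le] at h
  rcases h with h | h
  · have : smoothStep c ε =ᶠ[𝓝 r] fun _ => 0 := by
      filter_upwards [gt_mem_nhds h] with s hs using smoothStep_of_le hε hs.le
    rw [this.deriv_eq, deriv_const]
  · have : smoothStep c ε =ᶠ[𝓝 r] fun _ => 1 := by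
      filter_upwards [lt_mem_nhds h] with s hs using smoothStep_of_ge hε hs.le
    rw [this.deriv_eq, deriv_const]

theorem deriv_smoothStep_nonneg {c ε r : ℝ} (hε : 0 < ε) : 0 ≤ deriv (smoothStep c ε) r :=
  (smoothStep_mono hε).deriv_nonneg

theorem integral_deriv_smoothStep_mul {c ε : ℝ} (hε : 0 < ε) (Ψ : ℝ → ℝ) :
    ∫ r, deriv (smoothStep c ε) r * Ψ r
      = ∫ r in c..(c + ε), deriv (smoothStep c ε) r * Ψ r := by
  rw [intervalIntegral.integral_of_le (by linarith), ← integral_Icc_eq_integral_Ioc,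
    setIntegral_eq_integral_of_forall_compl_eq_zero]
  intro r hr
  rw [deriv_smoothStep_eq_zero hε hr, zero_mul]

theorem continuous_deriv_smoothStep (c ε : ℝ) : Continuous (deriv (smoothStep c ε)) :=
  (contDiff_smoothStep c ε).continuous_deriv le_rfl

/-- The derivative of the step is a probability density on `[c, c + ε]`, so the integral is an
average of values of `Ψ` near `c`. -/
theorem abs_integral_deriv_smoothStep_mul_sub_le {c ε η : ℝ} (hε : 0 < ε) {Ψ : ℝ → ℝ}
    (hΨ : ContinuousOn Ψ (Set.Icc c (c + ε)))
    (hη : ∀ r ∈ Set.Icc c (c + ε), |Ψ r - Ψ c| ≤ η) :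
    |(∫ r, deriv (smoothStep c ε) r * Ψ r) - Ψ c| ≤ η := by
  have hle : c ≤ c + ε := by linarith
  have hcont := continuous_deriv_smoothStep c ε
  have h1 : ∫ r in c..(c + ε), deriv (smoothStep c ε) r = 1 := by
    rw [intervalIntegral.integral_deriv_eq_sub
      (fun x _ => (contDiff_smoothStep c ε).differentiable one_ne_zero x)
      (hcont.intervalIntegrable _ _), smoothStep_of_ge hε le_rfl, smoothStep_of_le hε le_rfl]
    norm_num
  have hΨ' : ContinuousOn Ψ (Set.uIcc c (c + ε)) := by rwa [Set.uIcc_of_le hle]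
  have h2 : (∫ r, deriv (smoothStep c ε) r * Ψ r) - Ψ c
      = ∫ r in c..(c + ε), deriv (smoothStep c ε) r * (Ψ r - Ψ c) := by
    rw [integral_deriv_smoothStep_mul hε]
    simp_rw [mul_sub]
    have hi1 : IntervalIntegrable (fun r => deriv (smoothStep c ε) r * Ψ r) volume c (c + ε) :=
      (hcont.continuousOn.mul hΨ').intervalIntegrable
    have hi2 : IntervalIntegrable (fun r => deriv (smoothStep c ε) r * Ψ c) volume c (c + ε) :=
      (hcont.mul continuous_const).intervalIntegrable _ _
    rw [intervalIntegral.integral_sub hi1 hi2, intervalIntegral.integral_mul_const, h1, one_mul]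
  rw [h2]
  calc _ ≤ ∫ r in c..(c + ε), deriv (smoothStep c ε) r * η := by
        rw [← Real.norm_eq_abs]
        refine intervalIntegral.norm_integral_le_of_norm_le hle ?_
          ((hcont.mul continuous_const).intervalIntegrable _ _)
        refine Eventually.of_forall fun r hr => ?_
        rw [norm_mul, Real.norm_of_nonneg (deriv_smoothStep_nonneg hε), Real.norm_eq_abs]
        exact mul_le_mul_of_nonneg_left (hη r ⟨hr.1.le, hr.2⟩) (deriv_smoothStep_nonneg hε)
    _ = η := by rw [intervalIntegral.integral_mul_const, h1, one_mul]

theorem exists_smoothStep_close {c R η : ℝ} (hc : R < c) (hη : 0 < η) {Ψ : ℝ → ℝ}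
    (hΨ : ContinuousOn Ψ (Set.Ioi R)) :
    ∀ᶠ ε in 𝓝[>] (0 : ℝ), |(∫ r, deriv (smoothStep c ε) r * Ψ r) - Ψ c| ≤ η := by
  have h := (hΨ.continuousAt (Ioi_mem_nhds hc))
  obtain ⟨δ, hδ, hh⟩ := Metric.continuousAt_iff.1 h η hη
  filter_upwards [self_mem_nhdsWithin, mem_nhdsWithin_of_mem_nhds (gt_mem_nhds hδ)] with ε hε hεδ
  refine abs_integral_deriv_smoothStep_mul_sub_le hε
    (hΨ.mono fun r hr => lt_of_lt_of_le hc hr.1) fun r hr => ?_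
  have : dist r c < δ := by
    rw [Real.dist_eq, abs_of_nonneg (by linarith [hr.1])]; linarith [hr.2]
  exact (hh this).le

/-- A continuous function on a half-line has a limit at infinity if its distributional derivative
is small far out, when tested against smooth cutoff functions with values in `[0, 1]`. -/
theorem exists_tendsto_of_weak_bound {Ψ T : ℝ → ℝ} {R : ℝ} (hΨ : ContinuousOn Ψ (Set.Ioi R))
    (hT : Tendsto T atTop (𝓝 0))
    (h : ∀ a b, R < a → ∀ φ : ℝ → ℝ, ContDiff ℝ 1 φ → (∀ r, φ r ∈ Set.Icc (0 : ℝ) 1) →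
      (∀ r, r ∉ Set.Icc a b → φ r = 0) → |∫ r, deriv φ r * Ψ r| ≤ T a) :
    ∃ L, Tendsto Ψ atTop (𝓝 L) := by
  have key : ∀ c d, R < c → c ≤ d → |Ψ c - Ψ d| ≤ T c := by
    intro c d hc hcd
    refine le_of_forall_pos_le_add fun η hη => ?_
    have hd := hc.trans_le hcd
    obtain ⟨ε, ⟨h1, h2⟩, hε⟩ := (((exists_smoothStep_close hc (half_pos hη) hΨ).and
      (exists_smoothStep_close hd (half_pos hη) hΨ)).and self_mem_nhdsWithin).exists
    replace hε : 0 < ε := hε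
    have hint : ∀ c, R < c → Integrable fun r => deriv (smoothStep c ε) r * Ψ r := by
      intro c hc
      rw [← integrableOn_iff_integrable_of_support_subset (s := Set.Icc c (c + ε))]
      · exact ((continuous_deriv_smoothStep c ε).continuousOn.mul
          (hΨ.mono fun r hr => lt_of_lt_of_le hc hr.1)).integrableOn_compact isCompact_Icc
      · intro r hr
        by_contra hr'
        exact hr (by simp only [deriv_smoothStep_eq_zero hε hr', zero_mul])
    -- This difference of steps approximates the indicator of `[c, d]`; its derivative therefore
    -- tests `Ψ c - Ψ d` up to `η`.
    have h3 := h c (d + ε) hc (fun r => smoothStep c ε r - smoothStep d ε r)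
      ((contDiff_smoothStep c ε).sub (contDiff_smoothStep d ε)) ?_ ?_
    · have h4 : (∫ r, deriv (fun r => smoothStep c ε r - smoothStep d ε r) r * Ψ r)
          = (∫ r, deriv (smoothStep c ε) r * Ψ r) - ∫ r, deriv (smoothStep d ε) r * Ψ r := by
        rw [← integral_sub (hint c hc) (hint d hd)]
        congr 1
        ext r
        rw [deriv_fun_sub ((contDiff_smoothStep c ε).differentiable one_ne_zero r)
          ((contDiff_smoothStep d ε).differentiable one_ne_zero r), sub_mul]
      rw [h4] at h3
      rw [abs_le] at *
      constructor <;> linarith [h1.1, h1.2, h2.1, h2.2, h3.1, h3.2]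
    · intro r
      have : smoothStep d ε r ≤ smoothStep c ε r :=
        Real.smoothTransition.monotone (by gcongr)
      exact ⟨by linarith, by
        linarith [Real.smoothTransition.le_one ((r - c) / ε),
          Real.smoothTransition.nonneg ((r - d) / ε),
          show smoothStep c ε r = Real.smoothTransition ((r - c) / ε) from rfl,
          show smoothStep d ε r = Real.smoothTransition ((r - d) / ε) from rfl]⟩
    · intro r hr
      rw [Set.mem_Icc, not_and_or, not_le, not_le] at hr
      rcases hr with hr | hr
      · rw [smoothStep_of_le hε hr.le, smoothStep_of_le hε (by linarith), sub_self]
      · rw [smoothStep_of_ge hε (by linarith), smoothStep_of_ge hε hr.le, sub_self]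
  -- `key` holds only beyond `R`, so the argument is clamped at `R + 1` to get a Cauchy family on
  -- all of `ℝ`.
  have hmax : Tendsto (fun x : ℝ => max x (R + 1)) atTop atTop :=
    tendsto_atTop_mono (fun x => le_max_left _ _) tendsto_id
  have hC : CauchySeq fun x : ℝ => Ψ (max x (R + 1)) := by
    refine cauchySeq_of_le_tendsto_0' (fun x => T (max x (R + 1))) ?_ (hT.comp hmax)
    intro x y hxy
    rw [Real.dist_eq]
    exact key _ _ (lt_of_lt_of_le (by linarith) (le_max_right _ _)) (max_le_max hxy le_rfl)
  obtain ⟨L, hL⟩ := cauchySeq_tendsto_of_complete hC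
  refine ⟨L, hL.congr' ?_⟩
  filter_upwards [eventually_ge_atTop (R + 1)] with x hx
  rw [max_eq_left hx]

/-! ### Polar coordinates -/

section Polar

variable {E : Type*} [NormedAddCommGroup E] [NormedSpace ℝ E] [FiniteDimensional ℝ E]
  [MeasurableSpace E] [BorelSpace E] [Nontrivial E] (μ : Measure E) [μ.IsAddHaarMeasure]

/-- Away from the origin the space is the product of the unit sphere and a half-line, with density
`r ^ (dim - 1)` on the latter; the rest is Fubini. -/
theorem integral_eq_integral_toSphere {h : E → ℝ} (hh : Integrable h μ) :
    ∫ x, h x ∂μ = ∫ r in Set.Ioi (0 : ℝ), r ^ (Module.finrank ℝ E - 1) *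
      ∫ v : Metric.sphere (0 : E) 1, h (r • (v : E)) ∂μ.toSphere := by
  have hmp := μ.measurePreserving_homeomorphUnitSphereProd
  have hme := (homeomorphUnitSphereProd E).measurableEmbedding
  have hcongr : (fun x : ({0}ᶜ : Set E) => h x) = (fun p : Metric.sphere (0 : E) 1 ×
      Set.Ioi (0 : ℝ) => h ((p.2 : ℝ) • (p.1 : E))) ∘ homeomorphUnitSphereProd E := by
    ext x
    have := congrArg (fun y : ({0}ᶜ : Set E) => (y : E))
      ((homeomorphUnitSphereProd E).symm_apply_apply x)
    simp only [homeomorphUnitSphereProd_symm_apply_coe] at this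
    simp only [Function.comp_apply, this]
  have hint : Integrable (fun p : Metric.sphere (0 : E) 1 × Set.Ioi (0 : ℝ) =>
      h ((p.2 : ℝ) • (p.1 : E))) (μ.toSphere.prod (.volumeIoiPow (Module.finrank ℝ E - 1))) := by
    rw [← hmp.integrable_comp_emb hme, ← hcongr]
    have := hh.integrableOn (s := ({0}ᶜ : Set E))
    rwa [integrableOn_iff_comap_subtypeVal (measurableSet_singleton _).compl] at this
  calc ∫ x, h x ∂μ = ∫ x : ({(0)}ᶜ : Set E), h x ∂(μ.comap (↑)) := by
        rw [integral_subtype_comap (measurableSet_singleton _).compl fun x ↦ h x,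
          MeasureTheory.restrict_compl_singleton]
    _ = ∫ p, h ((p.2 : ℝ) • (p.1 : E)) ∂μ.toSphere.prod
          (.volumeIoiPow (Module.finrank ℝ E - 1)) := by
        rw [← hmp.integral_comp hme]
        exact congrArg (fun F => ∫ x, F x ∂(μ.comap (↑))) hcongr
    _ = ∫ r : Set.Ioi (0 : ℝ), ∫ v : Metric.sphere (0 : E) 1, h ((r : ℝ) • (v : E)) ∂μ.toSphere
          ∂.volumeIoiPow (Module.finrank ℝ E - 1) := integral_prod_symm _ hint
    _ = _ := by
      simp only [Measure.volumeIoiPow, ENNReal.ofReal]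
      rw [integral_withDensity_eq_integral_smul,
        integral_subtype_comap measurableSet_Ioi fun a ↦
          Real.toNNReal (a ^ (Module.finrank ℝ E - 1)) •
            ∫ v : Metric.sphere (0 : E) 1, h (a • (v : E)) ∂μ.toSphere,
        setIntegral_congr_fun measurableSet_Ioi fun x hx ↦ ?_]
      · rw [NNReal.smul_def, Real.coe_toNNReal _ (pow_nonneg hx.out.le _), smul_eq_mul]
      · exact (measurable_subtype_coe.pow_const _).real_toNNReal

end Polar

/-! ### Weak form of the divergence theorem -/

section Cutoff

variable {n : ℕ} {C : Set (EuclideanSpace ℝ (Fin (n + 1)))}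

/-- A closed cone with unique derivatives. -/
structure IsRegularCone (C : Set (EuclideanSpace ℝ (Fin (n + 1)))) : Prop where
  isClosed : IsClosed C
  uniqueDiffOn : UniqueDiffOn ℝ C
  smul_mem_iff : ∀ ρ : ℝ, 0 < ρ → ∀ v, ρ • v ∈ C ↔ v ∈ C

/-- The part of a set outside the closed unit ball. -/
def outer (C : Set (EuclideanSpace ℝ (Fin (n + 1)))) : Set (EuclideanSpace ℝ (Fin (n + 1))) :=
  C ∩ {x | 1 < ‖x‖}

theorem isOpen_one_lt_norm : IsOpen {x : EuclideanSpace ℝ (Fin (n + 1)) | 1 < ‖x‖} :=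
  isOpen_lt continuous_const continuous_norm

theorem IsRegularCone.uniqueDiffOn_outer (hC : IsRegularCone C) : UniqueDiffOn ℝ (outer C) :=
  hC.uniqueDiffOn.inter isOpen_one_lt_norm

theorem IsRegularCone.measurableSet_outer (hC : IsRegularCone C) : MeasurableSet (outer C) :=
  hC.isClosed.measurableSet.inter isOpen_one_lt_norm.measurableSet

/-- A function with support in a compact subinterval of `(1, ∞)`. -/
structure IsRadialCutoff (a b : ℝ) (φ : ℝ → ℝ) : Prop where
  one_lt : 1 < a
  contDiff : ContDiff ℝ 1 φ
  eq_zero : ∀ r, r ∉ Set.Icc a b → φ r = 0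

theorem IsRadialCutoff.deriv_eq_zero {a b : ℝ} {φ : ℝ → ℝ} (hφ : IsRadialCutoff a b φ) {r : ℝ}
    (hr : r ∉ Set.Icc a b) : deriv φ r = 0 := by
  have : φ =ᶠ[𝓝 r] fun _ => 0 := by
    filter_upwards [isClosed_Icc.isOpen_compl.mem_nhds hr] with s hs using hφ.eq_zero s hs
  rw [this.deriv_eq, deriv_const]

theorem IsRadialCutoff.eventuallyEq_zero {a b : ℝ} {φ : ℝ → ℝ} (hφ : IsRadialCutoff a b φ)
    (X : EuclideanSpace ℝ (Fin (n + 1)) → ℝ) {x : EuclideanSpace ℝ (Fin (n + 1))}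
    (hx : ‖x‖ ∉ Set.Icc a b) : (fun y => φ ‖y‖ * X y) =ᶠ[𝓝 x] fun _ => 0 := by
  filter_upwards [continuous_norm.continuousAt.preimage_mem_nhds
    (isClosed_Icc.isOpen_compl.mem_nhds hx)] with y hy
  rw [hφ.eq_zero _ hy, zero_mul]

/-- The cutoff vanishes for `‖x‖ < a` with `1 < a`, so a field known only outside the unit ball
extends by zero to the whole cone. -/
theorem IsRadialCutoff.contDiffOn_mul {a b : ℝ} {φ : ℝ → ℝ} (hφ : IsRadialCutoff a b φ)
    {X : EuclideanSpace ℝ (Fin (n + 1)) → ℝ} (hX : ContDiffOn ℝ 1 X (outer C)) :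
    ContDiffOn ℝ 1 (fun x => φ ‖x‖ * X x) C := by
  intro x hx
  by_cases h : 1 < ‖x‖
  · have h0 : x ≠ 0 := by rintro rfl; norm_num at h
    have h1 : ContDiffWithinAt ℝ 1 X C x := by
      have := hX x ⟨hx, h⟩
      rwa [outer, contDiffWithinAt_inter (isOpen_one_lt_norm.mem_nhds h)] at this
    exact ((hφ.contDiff.contDiffAt.comp x (contDiffAt_norm ℝ h0)).contDiffWithinAt).mul h1
  · have h1 : ‖x‖ ∉ Set.Icc a b := fun h' => h (hφ.one_lt.trans_le h'.1)
    exact (contDiffAt_const.congr_of_eventuallyEq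
      (hφ.eventuallyEq_zero X h1)).contDiffWithinAt

theorem hasFDerivAt_norm {x : EuclideanSpace ℝ (Fin (n + 1))} (hx : x ≠ 0) :
    HasFDerivAt (fun y : EuclideanSpace ℝ (Fin (n + 1)) => ‖y‖) (‖x‖⁻¹ • innerSL ℝ x) x := by
  have h1 := (hasStrictFDerivAt_norm_sq x).hasFDerivAt.sqrt (by positivity)
  simp only [Real.sqrt_sq (norm_nonneg _)] at h1
  refine h1.congr_fderiv ?_
  ext v
  simp only [_root_.smul_apply, smul_eq_mul, nsmul_eq_mul, Nat.cast_ofNat, one_div, mul_inv]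
  ring

theorem IsRadialCutoff.fderivWithin_mul {a b : ℝ} {φ : ℝ → ℝ} (hφ : IsRadialCutoff a b φ)
    (hC : IsRegularCone C) {X : EuclideanSpace ℝ (Fin (n + 1)) → ℝ}
    (hX : ContDiffOn ℝ 1 X (outer C)) {x : EuclideanSpace ℝ (Fin (n + 1))} (hx : x ∈ C)
    (j : Fin (n + 1)) :
    fderivWithin ℝ (fun x => φ ‖x‖ * X x) C x (EuclideanSpace.single j 1)
      = φ ‖x‖ * fderivWithin ℝ X (outer C) x (EuclideanSpace.single j 1)
        + deriv φ ‖x‖ * (‖x‖⁻¹ * (X x * x j)) := by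
  by_cases h : ‖x‖ ∈ Set.Icc a b
  · have h1 : 1 < ‖x‖ := hφ.one_lt.trans_le h.1
    have h0 : x ≠ 0 := by rintro rfl; norm_num at h1
    have hd : HasFDerivWithinAt X (fderivWithin ℝ X (outer C) x) C x := by
      have := ((hX x ⟨hx, h1⟩).differentiableWithinAt one_ne_zero).hasFDerivWithinAt
      rwa [outer, hasFDerivWithinAt_inter (isOpen_one_lt_norm.mem_nhds h1)] at this
    have hφ' : HasDerivAt φ (deriv φ ‖x‖) ‖x‖ :=
      (hφ.contDiff.differentiable one_ne_zero _).hasDerivAt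
    have h2 := (hφ'.comp_hasFDerivAt x (hasFDerivAt_norm h0)).hasFDerivWithinAt (s := C)
    have h3 := (h2.mul hd).fderivWithin (hC.uniqueDiffOn x hx)
    have h4 : (fun x => φ ‖x‖ * X x) = (φ ∘ fun y => ‖y‖) * X := rfl
    rw [h4, h3]
    simp only [Function.comp_apply, _root_.add_apply, _root_.smul_apply, smul_eq_mul,
      innerSL_apply_apply]
    rw [EuclideanSpace.inner_single_right]
    simp
    ring
  · rw [hφ.eq_zero _ h, hφ.deriv_eq_zero h]
    have h3 := ((hφ.eventuallyEq_zero X h).filter_mono nhdsWithin_le_nhds).fderivWithin_eq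
      (𝕜 := ℝ) (s := C) (hφ.eventuallyEq_zero X h).self_of_nhds
    rw [h3]
    simp

/-- The flux of a vector field through the part of the sphere of radius `ρ` in `U`. -/
noncomputable def flux (U : Set (EuclideanSpace ℝ (Fin (n + 1))))
    (X : Fin (n + 1) → EuclideanSpace ℝ (Fin (n + 1)) → ℝ) (ρ : ℝ) : ℝ :=
  ρ ^ n * ∫ v in {v : Metric.sphere (0 : EuclideanSpace ℝ (Fin (n + 1))) 1 |
      ρ • (v : EuclideanSpace ℝ (Fin (n + 1))) ∈ U},
    (∑ j, X j (ρ • (v : EuclideanSpace ℝ (Fin (n + 1)))) * (v : EuclideanSpace ℝ (Fin (n + 1))) j)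
      ∂(volume : Measure (EuclideanSpace ℝ (Fin (n + 1)))).toSphere

/-- The divergence of a vector field on `U`. -/
noncomputable def divergence (U : Set (EuclideanSpace ℝ (Fin (n + 1))))
    (X : Fin (n + 1) → EuclideanSpace ℝ (Fin (n + 1)) → ℝ)
    (x : EuclideanSpace ℝ (Fin (n + 1))) : ℝ :=
  ∑ j, fderivWithin ℝ (X j) U x (EuclideanSpace.single j 1)

/-- By homogeneity of the cone, the domain of integration in the flux is one fixed compact part of
the unit sphere, independent of `ρ`. -/
theorem IsRegularCone.setOf_smul_mem_outer (hC : IsRegularCone C) {ρ : ℝ} (hρ : 1 < ρ) :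
    {v : Metric.sphere (0 : EuclideanSpace ℝ (Fin (n + 1))) 1 |
      ρ • (v : EuclideanSpace ℝ (Fin (n + 1))) ∈ outer C}
      = {v : Metric.sphere (0 : EuclideanSpace ℝ (Fin (n + 1))) 1 |
        (v : EuclideanSpace ℝ (Fin (n + 1))) ∈ C} := by
  ext v
  have h0 : 0 < ρ := by linarith
  simp [outer, hC.smul_mem_iff ρ h0, norm_smul, abs_of_pos h0, hρ]

theorem IsRegularCone.isCompact_sphere_inter (hC : IsRegularCone C) :
    IsCompact {v : Metric.sphere (0 : EuclideanSpace ℝ (Fin (n + 1))) 1 |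
      (v : EuclideanSpace ℝ (Fin (n + 1))) ∈ C} :=
  (hC.isClosed.preimage continuous_subtype_val).isCompact

theorem IsRegularCone.smul_mem_outer (hC : IsRegularCone C) {ρ : ℝ} (hρ : 1 < ρ)
    {v : Metric.sphere (0 : EuclideanSpace ℝ (Fin (n + 1))) 1}
    (hv : (v : EuclideanSpace ℝ (Fin (n + 1))) ∈ C) :
    ρ • (v : EuclideanSpace ℝ (Fin (n + 1))) ∈ outer C := by
  have h : v ∈ {v : Metric.sphere (0 : EuclideanSpace ℝ (Fin (n + 1))) 1 |
      ρ • (v : EuclideanSpace ℝ (Fin (n + 1))) ∈ outer C} := by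
    rw [hC.setOf_smul_mem_outer hρ]
    exact hv
  exact h

theorem IsRegularCone.continuousOn_flux (hC : IsRegularCone C)
    {X : Fin (n + 1) → EuclideanSpace ℝ (Fin (n + 1)) → ℝ}
    (hX : ∀ j, ContinuousOn (X j) (outer C)) :
    ContinuousOn (flux (outer C) X) (Set.Ioi 1) := by
  set K := {v : Metric.sphere (0 : EuclideanSpace ℝ (Fin (n + 1))) 1 |
      (v : EuclideanSpace ℝ (Fin (n + 1))) ∈ C} with hK
  have hKc : IsCompact K := hC.isCompact_sphere_inter
  have : CompactSpace K := isCompact_iff_compactSpace.1 hKc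
  rw [continuousOn_iff_continuous_domRestrict]
  -- Both `ρ` and `v` are moved to subtypes, since the integrand is continuous only where `ρ • v`
  -- lies in `outer C`.
  have key : (Set.Ioi (1 : ℝ)).domRestrict (flux (outer C) X) = fun ρ : Set.Ioi (1 : ℝ) =>
      (ρ : ℝ) ^ n * ∫ v : K in Set.univ,
        (∑ j, X j ((ρ : ℝ) • ((v : Metric.sphere (0 : EuclideanSpace ℝ (Fin (n + 1))) 1) :
          EuclideanSpace ℝ (Fin (n + 1)))) *
        ((v : Metric.sphere (0 : EuclideanSpace ℝ (Fin (n + 1))) 1) :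
          EuclideanSpace ℝ (Fin (n + 1))) j)
        ∂((volume : Measure (EuclideanSpace ℝ (Fin (n + 1)))).toSphere.comap (↑)) := by
    ext ⟨ρ, hρ⟩
    rw [setIntegral_univ, Set.domRestrict_apply, flux, hC.setOf_smul_mem_outer hρ]
    rw [integral_subtype_comap hKc.measurableSet (f := fun v => ∑ j, X j (ρ •
      (v : EuclideanSpace ℝ (Fin (n + 1)))) * (v : EuclideanSpace ℝ (Fin (n + 1))) j)]
  have hfin : IsFiniteMeasure
      ((volume : Measure (EuclideanSpace ℝ (Fin (n + 1)))).toSphere.comap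
        (Subtype.val : K → _)) := by
    constructor
    rw [comap_subtype_coe_apply hKc.measurableSet]
    exact measure_lt_top _ _
  rw [key]
  refine (continuous_subtype_val.pow n).mul ?_
  have : LocallyCompactSpace (Set.Ioi (1 : ℝ)) := isOpen_Ioi.locallyCompactSpace
  refine continuous_parametric_integral_of_continuous ?_ isCompact_univ
  refine continuous_finsetSum _ fun j _ => ?_
  refine Continuous.mul ?_ (by fun_prop)
  refine (hX j).comp_continuous (by fun_prop) ?_
  rintro ⟨ρ, v⟩
  exact hC.smul_mem_outer ρ.2 v.2

theorem continuousOn_radial_mul {a b : ℝ} {φ : ℝ → ℝ} (ha : 1 < a)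
    (hφ : Continuous φ) (h0 : ∀ r, r ∉ Set.Icc a b → φ r = 0)
    {X : EuclideanSpace ℝ (Fin (n + 1)) → ℝ} (hX : ContinuousOn X (outer C)) :
    ContinuousOn (fun x => φ ‖x‖ * X x) C := by
  intro x hx
  by_cases h : 1 < ‖x‖
  · have h1 : ContinuousWithinAt X C x := by
      have := hX x ⟨hx, h⟩
      rwa [outer, continuousWithinAt_inter (isOpen_one_lt_norm.mem_nhds h)] at this
    exact (hφ.comp continuous_norm).continuousAt.continuousWithinAt.mul h1
  · have h1 : ‖x‖ ∉ Set.Icc a b := fun h' => h (ha.trans_le h'.1)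
    have h2 : (fun y => φ ‖y‖ * X y) =ᶠ[𝓝 x] fun _ => 0 := by
      filter_upwards [continuous_norm.continuousAt.preimage_mem_nhds
        (isClosed_Icc.isOpen_compl.mem_nhds h1)] with y hy
      rw [h0 _ hy, zero_mul]
    exact (continuousAt_const.congr h2.symm).continuousWithinAt

theorem IsRegularCone.integrableOn_radial_mul (hC : IsRegularCone C) {a b : ℝ} {φ : ℝ → ℝ}
    (ha : 1 < a) (hφ : Continuous φ) (h0 : ∀ r, r ∉ Set.Icc a b → φ r = 0)
    {X : EuclideanSpace ℝ (Fin (n + 1)) → ℝ} (hX : ContinuousOn X (outer C)) :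
    IntegrableOn (fun x => φ ‖x‖ * X x) C := by
  have hc : IsCompact (C ∩ Metric.closedBall 0 b) :=
    (isCompact_closedBall _ _).inter_left hC.isClosed
  have h1 := ((continuousOn_radial_mul ha hφ h0 hX).mono
    Set.inter_subset_left).integrableOn_compact (μ := volume) hc
  refine h1.of_forall_sdiff_eq_zero hC.isClosed.measurableSet fun x hx => ?_
  rw [h0, zero_mul]
  intro h
  exact hx.2 ⟨hx.1, by simpa using h.2⟩

/-- Polar coordinates for the integral of a radial function times a radial component. -/
theorem IsRegularCone.integral_radial_mul (hC : IsRegularCone C) {a b : ℝ} {φ : ℝ → ℝ}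
    (ha : 1 < a) (hφ : Continuous φ) (h0 : ∀ r, r ∉ Set.Icc a b → φ r = 0)
    {X : Fin (n + 1) → EuclideanSpace ℝ (Fin (n + 1)) → ℝ}
    (hX : ∀ j, ContinuousOn (X j) (outer C)) :
    ∫ x in C, φ ‖x‖ * (‖x‖⁻¹ * ∑ j, X j x * x j) = ∫ r, φ r * flux (outer C) X r := by
  have hcont : ContinuousOn (fun x => ‖x‖⁻¹ * ∑ j, X j x * x j) (outer C) := by
    refine ContinuousOn.mul ?_ ?_
    · refine continuous_norm.continuousOn.inv₀ fun x hx => ?_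
      have : 1 < ‖x‖ := hx.2
      linarith
    · exact continuousOn_finsetSum _ fun j _ => (hX j).mul (by fun_prop)
  have hint := hC.integrableOn_radial_mul ha hφ h0 hcont
  rw [← integral_indicator hC.isClosed.measurableSet,
    integral_eq_integral_toSphere volume (hint.integrable_indicator hC.isClosed.measurableSet)]
  have hz : ∀ r, r ∉ Set.Ioi (0 : ℝ) → φ r * flux (outer C) X r = 0 := by
    intro r hr
    rw [h0, zero_mul]
    intro h
    exact hr (by have := h.1; simp only [Set.mem_Ioi]; linarith)
  rw [← setIntegral_eq_integral_of_forall_compl_eq_zero hz]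
  refine setIntegral_congr_fun measurableSet_Ioi fun r hr => ?_
  replace hr : 0 < r := hr
  simp only [finrank_euclideanSpace, Fintype.card_fin, Nat.add_sub_cancel]
  by_cases hr1 : r ∈ Set.Icc a b
  · have h1 : 1 < r := ha.trans_le hr1.1
    rw [flux, hC.setOf_smul_mem_outer h1]
    rw [← integral_indicator hC.isCompact_sphere_inter.measurableSet, ← mul_assoc, mul_comm (φ r),
      mul_assoc, ← integral_const_mul (φ r)]
    congr 2
    ext v
    by_cases hv : (v : EuclideanSpace ℝ (Fin (n + 1))) ∈ C
    · rw [Set.indicator_of_mem ((hC.smul_mem_iff r hr _).2 hv), Set.indicator_of_mem (by exact hv)]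
      simp only [norm_smul, Real.norm_of_nonneg hr.le, norm_eq_of_mem_sphere, mul_one,
        PiLp.smul_apply, smul_eq_mul]
      rw [Finset.mul_sum]
      congr 1
      refine Finset.sum_congr rfl fun j _ => ?_
      field_simp
    · rw [Set.indicator_of_notMem (fun h => hv ((hC.smul_mem_iff r hr _).1 h)),
        Set.indicator_of_notMem (by exact hv), mul_zero]
  · rw [h0 _ hr1, zero_mul]
    have : ∀ v : Metric.sphere (0 : EuclideanSpace ℝ (Fin (n + 1))) 1,
        C.indicator (fun x => φ ‖x‖ * (‖x‖⁻¹ * ∑ j, X j x * x j))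
          (r • (v : EuclideanSpace ℝ (Fin (n + 1)))) = 0 := by
      intro v
      rw [Set.indicator_apply_eq_zero]
      intro _
      simp only [norm_smul, Real.norm_of_nonneg hr.le, norm_eq_of_mem_sphere, mul_one, h0 _ hr1,
        zero_mul]
    simp [this]

/-- The weak divergence identity on a cone, with the boundary term left as the integral of a
divergence. -/
theorem IsRegularCone.integral_deriv_mul_flux (hC : IsRegularCone C) {a b : ℝ} {φ : ℝ → ℝ}
    (hφ : IsRadialCutoff a b φ) {X : Fin (n + 1) → EuclideanSpace ℝ (Fin (n + 1)) → ℝ}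
    (hX : ∀ j, ContDiffOn ℝ 1 (X j) (outer C)) :
    ∫ r, deriv φ r * flux (outer C) X r
      = (∫ x in C, divergence C (fun j x => φ ‖x‖ * X j x) x)
        - ∫ x in outer C, φ ‖x‖ * divergence (outer C) X x := by
  have hdc : Continuous (deriv φ) := hφ.contDiff.continuous_deriv le_rfl
  have hz : ∀ r, r ∉ Set.Icc a b → deriv φ r = 0 := fun r hr => hφ.deriv_eq_zero hr
  rw [← hC.integral_radial_mul hφ.one_lt hdc hz fun j => (hX j).continuousOn]
  have hcont : ContinuousOn (fun x => ‖x‖⁻¹ * ∑ j, X j x * x j) (outer C) := by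
    refine ContinuousOn.mul ?_ ?_
    · refine continuous_norm.continuousOn.inv₀ fun x hx => ?_
      have : 1 < ‖x‖ := hx.2
      linarith
    · exact continuousOn_finsetSum _ fun j _ => (hX j).continuousOn.mul (by fun_prop)
  have hdiv : ContinuousOn (divergence (outer C) X) (outer C) := by
    refine continuousOn_finsetSum _ fun j _ => ?_
    exact ((hX j).continuousOn_fderivWithin hC.uniqueDiffOn_outer le_rfl).clm_apply
      continuousOn_const
  have hi1 := hC.integrableOn_radial_mul hφ.one_lt hdc hz hcont
  have hi2 := hC.integrableOn_radial_mul hφ.one_lt hφ.contDiff.continuous hφ.eq_zero hdiv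
  have h1 : ∫ x in outer C, φ ‖x‖ * divergence (outer C) X x
      = ∫ x in C, φ ‖x‖ * divergence (outer C) X x := by
    refine (setIntegral_eq_of_subset_of_forall_sdiff_eq_zero hC.isClosed.measurableSet
      Set.inter_subset_left fun x hx => ?_).symm
    rw [hφ.eq_zero, zero_mul]
    intro h
    exact hx.2 ⟨hx.1, hφ.one_lt.trans_le h.1⟩
  rw [h1, eq_sub_iff_add_eq, ← integral_add hi1 hi2]
  -- Pointwise this is the product rule `div (φ X) = φ div X + φ' ⟨X, x / ‖x‖⟩`.
  refine setIntegral_congr_fun hC.isClosed.measurableSet fun x hx => ?_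
  simp only [divergence]
  rw [Finset.mul_sum, Finset.mul_sum, Finset.mul_sum, ← Finset.sum_add_distrib]
  refine Finset.sum_congr rfl fun j _ => ?_
  rw [hφ.fderivWithin_mul hC (hX j) hx, add_comm]

end Cutoff

/-! ### The divergence identity on the whole space -/

section Univ

variable {n : ℕ}

theorem isRegularCone_univ : IsRegularCone (Set.univ : Set (EuclideanSpace ℝ (Fin (n + 1)))) :=
  ⟨isClosed_univ, uniqueDiffOn_univ, by simp⟩

theorem integral_divergence_eq_zero {V : Fin (n + 1) → EuclideanSpace ℝ (Fin (n + 1)) → ℝ}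
    (hV : ∀ j, ContDiff ℝ 1 (V j)) (hs : ∀ j, HasCompactSupport (V j)) :
    ∫ x in Set.univ, divergence Set.univ V x = 0 := by
  simp only [divergence, setIntegral_univ, fderivWithin_univ]
  have hi : ∀ j, Integrable fun x => fderiv ℝ (V j) x (EuclideanSpace.single j 1) := fun j =>
    (((hV j).continuous_fderiv one_ne_zero).clm_apply
      continuous_const).integrable_of_hasCompactSupport ((hs j).fderiv_apply ℝ _)
  rw [integral_finsetSum _ fun j _ => hi j]
  refine Finset.sum_eq_zero fun j _ => ?_
  -- Integration by parts against the constant function `1`.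
  have := integral_mul_fderiv_eq_neg_fderiv_mul_of_integrable (μ := volume) (𝕜 := ℝ)
    (f := fun _ : EuclideanSpace ℝ (Fin (n + 1)) => (1 : ℝ)) (g := V j)
    (v := EuclideanSpace.single j 1) (by simp) (by simpa using hi j)
    (by simpa using (hV j).continuous.integrable_of_hasCompactSupport (hs j))
    (fun x _ => differentiableAt_const _) (fun x _ => (hV j).differentiable one_ne_zero x)
  simpa using this

theorem IsRadialCutoff.hasCompactSupport {a b : ℝ} {φ : ℝ → ℝ} (hφ : IsRadialCutoff a b φ)
    (X : EuclideanSpace ℝ (Fin (n + 1)) → ℝ) : HasCompactSupport fun x => φ ‖x‖ * X x := by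
  refine HasCompactSupport.of_support_subset_isCompact
    (isCompact_closedBall (0 : EuclideanSpace ℝ (Fin (n + 1))) b) fun x hx => ?_
  by_contra h
  refine hx ?_
  simp only
  rw [hφ.eq_zero, zero_mul]
  intro h'
  exact h (by simpa using h'.2)

theorem IsRadialCutoff.integral_deriv_mul_flux_univ {a b : ℝ} {φ : ℝ → ℝ}
    (hφ : IsRadialCutoff a b φ) {X : Fin (n + 1) → EuclideanSpace ℝ (Fin (n + 1)) → ℝ}
    (hX : ∀ j, ContDiffOn ℝ 1 (X j) (outer Set.univ)) :
    ∫ r, deriv φ r * flux (outer Set.univ) X r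
      = - ∫ x in outer Set.univ, φ ‖x‖ * divergence (outer Set.univ) X x := by
  rw [isRegularCone_univ.integral_deriv_mul_flux hφ hX, integral_divergence_eq_zero, zero_sub]
  · exact fun j => contDiffOn_univ.1 (hφ.contDiffOn_mul (hX j))
  · exact fun j => hφ.hasCompactSupport _

end Univ

/-! ### The divergence theorem on the half-space and convergence of fluxes -/

/-- The closed half-space `x₃ ≥ 0`. -/
def halfSpace : Set E3 := {x | 0 ≤ x 2}

theorem isClosed_halfSpace : IsClosed halfSpace :=
  isClosed_le continuous_const (by fun_prop)

theorem convex_halfSpace : Convex ℝ halfSpace := by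
  intro x hx y hy s t hs ht _
  have hx' : 0 ≤ x 2 := hx
  have hy' : 0 ≤ y 2 := hy
  change 0 ≤ (s • x + t • y) 2
  simp only [PiLp.add_apply, PiLp.smul_apply, smul_eq_mul]
  positivity

theorem isOpen_pos_halfSpace : IsOpen {x : E3 | 0 < x 2} :=
  isOpen_lt continuous_const (by fun_prop)

theorem pos_subset_halfSpace : {x : E3 | 0 < x 2} ⊆ halfSpace := fun x hx =>
  le_of_lt (show 0 < x 2 from hx)

theorem isRegularCone_halfSpace : IsRegularCone (n := 2) halfSpace where
  isClosed := isClosed_halfSpace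
  uniqueDiffOn := by
    refine uniqueDiffOn_convex convex_halfSpace ⟨EuclideanSpace.single 2 1, ?_⟩
    refine interior_maximal pos_subset_halfSpace isOpen_pos_halfSpace ?_
    simp
  smul_mem_iff ρ hρ v := by
    change 0 ≤ ρ * v 2 ↔ 0 ≤ v 2
    exact mul_nonneg_iff_of_pos_left hρ

theorem outer_univ_eq_exterior : outer (n := 2) Set.univ = exterior := by
  ext x; simp [outer, exterior]

theorem outer_halfSpace_eq : outer (n := 2) halfSpace = halfExterior := by
  ext x; simp [outer, halfExterior, halfSpace]

theorem inPlane_apply_castSucc (z : E2) (i : Fin 2) : inPlane z i.castSucc = z i := by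
  fin_cases i <;> simp [inPlane]

theorem inPlane_apply_two (z : E2) : inPlane z 2 = 0 := by
  simp [inPlane]

theorem norm_inPlane (z : E2) : ‖inPlane z‖ = ‖z‖ := by
  simp [EuclideanSpace.norm_eq, Fin.sum_univ_three, inPlane]

/-- The divergence theorem on the half-space, for compactly supported vector fields. -/
theorem integral_divergence_halfSpace {V : Fin 3 → E3 → ℝ} {b : ℝ}
    (hV : ∀ j, ContDiffOn ℝ 1 (V j) halfSpace) (hb : ∀ j x, b < ‖x‖ → V j x = 0) :
    ∫ x in halfSpace, divergence (n := 2) halfSpace V x = - ∫ z : E2, V 2 (inPlane z) := by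
  -- The box `[-B, B]² × [0, B]` contains the support of `V` in the half-space, and `V` vanishes on
  -- all its faces except the bottom one.
  set B : ℝ := |b| + 1 with hB
  have hbB : b < B := by linarith [le_abs_self b]
  have hB0 : 0 < B := by positivity
  set lo : Fin 3 → ℝ := ![-B, -B, 0] with hlo
  set hi : Fin 3 → ℝ := ![B, B, B] with hhi
  have hle : lo ≤ hi := by
    intro i
    fin_cases i <;> simp [lo, hi] <;> linarith
  have hnorm : ∀ (y : Fin 3 → ℝ) i, B ≤ |y i| → b < ‖(WithLp.toLp 2 y : E3)‖ := by
    intro y i h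
    have := PiLp.norm_apply_le (WithLp.toLp 2 y : E3) i
    rw [Real.norm_eq_abs] at this
    exact hbB.trans_le (h.trans this)
  have hIcc : ∀ y ∈ Set.Icc lo hi, (WithLp.toLp 2 y : E3) ∈ halfSpace := by
    intro y hy
    have := hy.1 2
    simpa [lo, halfSpace] using this
  have hdcont : ContinuousOn (divergence (n := 2) halfSpace V) halfSpace := by
    refine continuousOn_finsetSum _ fun j _ => ?_
    exact ((hV j).continuousOn_fderivWithin isRegularCone_halfSpace.uniqueDiffOn
      le_rfl).clm_apply continuousOn_const
  have hzero : ∀ x, b < ‖x‖ → divergence (n := 2) halfSpace V x = 0 := by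
    intro x hx
    refine Finset.sum_eq_zero fun j _ => ?_
    have he : V j =ᶠ[𝓝 x] fun _ => 0 := by
      filter_upwards [continuous_norm.continuousAt.preimage_mem_nhds (lt_mem_nhds hx)] with y hy
      exact hb j y hy
    rw [(he.filter_mono nhdsWithin_le_nhds).fderivWithin_eq he.self_of_nhds]
    simp
  let L : (Fin 3 → ℝ) →L[ℝ] E3 := (EuclideanSpace.equiv (Fin 3) ℝ).symm.toContinuousLinearMap
  have hL : ∀ y, L y = WithLp.toLp 2 y := fun y => rfl
  have hLmaps : Set.MapsTo L (Set.Icc lo hi) halfSpace := fun y hy => hIcc y hy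
  have hmp : MeasurePreserving (WithLp.toLp 2 : (Fin 3 → ℝ) → E3) :=
    PiLp.volume_preserving_toLp (Fin 3)
  have hme : MeasurableEmbedding (WithLp.toLp 2 : (Fin 3 → ℝ) → E3) :=
    (MeasurableEquiv.toLp 2 (Fin 3 → ℝ)).measurableEmbedding
  have h1 : ∫ x in halfSpace, divergence (n := 2) halfSpace V x
      = ∫ y in Set.Icc lo hi, divergence (n := 2) halfSpace V (L y) := by
    rw [← hmp.setIntegral_preimage_emb hme]
    refine setIntegral_eq_of_subset_of_forall_sdiff_eq_zero
      (hme.measurable isClosed_halfSpace.measurableSet) hLmaps fun y hy => ?_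
    have hy2 : 0 ≤ y 2 := hy.1
    have : ∃ i, B ≤ |y i| := by
      by_contra! hcon
      refine hy.2 ⟨fun i => ?_, fun i => ?_⟩
      · have := (abs_lt.1 (hcon i)).1
        fin_cases i
        · simpa [lo] using this.le
        · simpa [lo] using this.le
        · simpa [lo] using hy2
      · have := (abs_lt.1 (hcon i)).2
        fin_cases i <;> simpa [hi] using this.le
    obtain ⟨i, hi⟩ := this
    exact hzero _ (hnorm y i hi)
  -- Differentiability is needed only inside the box, where the derivative within the half-space is
  -- a full derivative; continuity suffices on the boundary.
  have h2 := integral_divergence_of_hasFDerivAt_off_countable' lo hi hle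
    (fun j y => V j (L y)) (fun j y => (fderivWithin ℝ (V j) halfSpace (L y)).comp L) ∅
    Set.countable_empty (fun j => (hV j).continuousOn.comp L.continuous.continuousOn hLmaps)
    (by
      intro y hy j
      have hy2 : 0 < (L y) 2 := by
        have := (hy.1 2 (Set.mem_univ _)).1
        simpa [lo, hL] using this
      have hnhds : halfSpace ∈ 𝓝 (L y) :=
        mem_of_superset (isOpen_pos_halfSpace.mem_nhds hy2) pos_subset_halfSpace
      have hd := ((hV j _ (pos_subset_halfSpace hy2)).differentiableWithinAt
        one_ne_zero).hasFDerivWithinAt.hasFDerivAt hnhds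
      exact hd.comp y L.hasFDerivAt)
    (by
      have : ContinuousOn (fun y => divergence (n := 2) halfSpace V (L y)) (Set.Icc lo hi) :=
        hdcont.comp L.continuous.continuousOn hLmaps
      exact this.integrableOn_compact isCompact_Icc)
  have h3 : ∀ y, divergence (n := 2) halfSpace V (L y)
      = ∑ i, ((fderivWithin ℝ (V i) halfSpace (L y)).comp L) (Pi.single i 1) := fun y => rfl
  rw [h1]
  simp_rw [h3]
  rw [h2, Fin.sum_univ_three]
  have hface : ∀ (j i : Fin 3) (c : ℝ) (z : Fin 2 → ℝ), B ≤ |c| →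
      V j (L (i.insertNth c z)) = 0 := by
    intro j i c z hc
    exact hb _ _ (hnorm _ i (by simpa using hc))
  have e0 : B ≤ |hi 0| := by simp [hi, le_abs_self]
  have e1 : B ≤ |hi 1| := by simp [hi, le_abs_self]
  have e2 : B ≤ |hi 2| := by simp [hi, le_abs_self]
  have e3 : B ≤ |lo 0| := by simp [lo, le_abs_self]
  have e4 : B ≤ |lo 1| := by simp [lo, le_abs_self]
  simp only [hface _ _ _ _ e0, hface _ _ _ _ e1, hface _ _ _ _ e2, hface _ _ _ _ e3,
    hface _ _ _ _ e4, integral_zero, sub_self, zero_add, zero_sub]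
  congr 1
  have hmp2 : MeasurePreserving (WithLp.toLp 2 : (Fin 2 → ℝ) → E2) :=
    PiLp.volume_preserving_toLp (Fin 2)
  have hme2 : MeasurableEmbedding (WithLp.toLp 2 : (Fin 2 → ℝ) → E2) :=
    (MeasurableEquiv.toLp 2 (Fin 2 → ℝ)).measurableEmbedding
  rw [← hmp2.integral_comp hme2]
  have hins : ∀ z : Fin 2 → ℝ, L ((2 : Fin 3).insertNth (lo 2) z) = inPlane (WithLp.toLp 2 z) := by
    intro z
    ext i
    have : (2 : Fin 3) = Fin.last 2 := rfl
    rw [this, Fin.insertNth_last']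
    fin_cases i <;> simp [hL, inPlane, lo, Fin.snoc]
  simp_rw [hins]
  refine setIntegral_eq_integral_of_forall_compl_eq_zero fun z hz => ?_
  refine hb _ _ ?_
  have : ∃ i, B ≤ |z i| := by
    by_contra! hcon
    refine hz ⟨fun i => ?_, fun i => ?_⟩
    · have := (abs_lt.1 (hcon i)).1
      fin_cases i <;> simpa [lo, Fin.succAbove] using this.le
    · have := (abs_lt.1 (hcon i)).2
      fin_cases i <;> simpa [hi, Fin.succAbove] using this.le
  obtain ⟨i, hi⟩ := this
  rw [norm_inPlane]
  have h4 := PiLp.norm_apply_le (WithLp.toLp 2 z : E2) i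
  rw [Real.norm_eq_abs] at h4
  exact hbB.trans_le (hi.trans h4)

/-- The outer normal of the half-space is `-∂₃`, so its boundary contributes minus the integral of
the third component. -/
theorem IsRadialCutoff.integral_deriv_mul_flux_halfSpace {a b : ℝ} {φ : ℝ → ℝ}
    (hφ : IsRadialCutoff a b φ) {X : Fin 3 → E3 → ℝ}
    (hX : ∀ j, ContDiffOn ℝ 1 (X j) (outer (n := 2) halfSpace)) :
    ∫ r, deriv φ r * flux (n := 2) (outer (n := 2) halfSpace) X r
      = - (∫ z : E2, φ ‖z‖ * X 2 (inPlane z))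
        - ∫ x in outer (n := 2) halfSpace,
            φ ‖x‖ * divergence (n := 2) (outer (n := 2) halfSpace) X x := by
  rw [isRegularCone_halfSpace.integral_deriv_mul_flux hφ hX,
    integral_divergence_halfSpace (b := b) (fun j => hφ.contDiffOn_mul (hX j))]
  · refine congrArg₂ _ (congrArg _ (integral_congr_ae (.of_forall fun z => ?_))) rfl
    exact congrArg (fun r => φ r * X 2 (inPlane z)) (norm_inPlane z)
  · intro j x hx
    rw [hφ.eq_zero, zero_mul]
    exact fun h => absurd h.2 (not_le.2 hx)

/-! ### Convergence of fluxes -/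

section Tail

variable {n : ℕ}

/-- The integral of `|h|` over the part of `U` outside the ball of radius `a`. -/
noncomputable def tailIntegral (U : Set (EuclideanSpace ℝ (Fin (n + 1))))
    (h : EuclideanSpace ℝ (Fin (n + 1)) → ℝ) (a : ℝ) : ℝ :=
  ∫ x in U ∩ {x | a ≤ ‖x‖}, |h x|

theorem measurableSet_le_norm (a : ℝ) :
    MeasurableSet {x : EuclideanSpace ℝ (Fin (n + 1)) | a ≤ ‖x‖} :=
  (isClosed_le continuous_const continuous_norm).measurableSet

/-- The regions of integration decrease to the empty set, and one of the integrals is finite. -/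
theorem tendsto_tailIntegral {U : Set (EuclideanSpace ℝ (Fin (n + 1)))} (hU : MeasurableSet U)
    {h : EuclideanSpace ℝ (Fin (n + 1)) → ℝ} {R : ℝ}
    (hh : IntegrableOn h (U ∩ {x | R ≤ ‖x‖})) :
    Tendsto (tailIntegral U h) atTop (𝓝 0) := by
  have hempty : (⋂ a : ℝ, U ∩ {x : EuclideanSpace ℝ (Fin (n + 1)) | a ≤ ‖x‖}) = ∅ := by
    refine Set.eq_empty_of_forall_notMem fun x hx => ?_
    have := (Set.mem_iInter.1 hx (‖x‖ + 1)).2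
    simp only [Set.mem_ofPred_eq] at this
    linarith
  have := tendsto_setIntegral_of_antitone (μ := volume) (f := fun x => |h x|)
    (s := fun a : ℝ => U ∩ {x : EuclideanSpace ℝ (Fin (n + 1)) | a ≤ ‖x‖})
    (fun a => hU.inter (measurableSet_le_norm a))
    (fun a b hab x hx => ⟨hx.1, le_trans hab hx.2⟩) ⟨R, hh.abs⟩
  rwa [hempty, setIntegral_empty] at this

theorem IsRadialCutoff.abs_integral_mul_le {a b : ℝ} {φ : ℝ → ℝ} (hφ : IsRadialCutoff a b φ)
    (h01 : ∀ r, φ r ∈ Set.Icc (0 : ℝ) 1) {U : Set (EuclideanSpace ℝ (Fin (n + 1)))}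
    (hU : MeasurableSet U) {h : EuclideanSpace ℝ (Fin (n + 1)) → ℝ}
    (hh : IntegrableOn h (U ∩ {x | a ≤ ‖x‖})) :
    |∫ x in U, φ ‖x‖ * h x| ≤ tailIntegral U h a := by
  have h1 : ∫ x in U, φ ‖x‖ * h x = ∫ x in U ∩ {x | a ≤ ‖x‖}, φ ‖x‖ * h x := by
    refine setIntegral_eq_of_subset_of_forall_sdiff_eq_zero hU Set.inter_subset_left fun x hx => ?_
    rw [hφ.eq_zero, zero_mul]
    exact fun h' => hx.2 ⟨hx.1, h'.1⟩
  rw [h1, ← Real.norm_eq_abs]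
  refine norm_integral_le_of_norm_le hh.abs (Eventually.of_forall fun x => ?_)
  rw [norm_mul, Real.norm_eq_abs, Real.norm_eq_abs, abs_of_nonneg (h01 _).1]
  exact mul_le_of_le_one_left (abs_nonneg _) (h01 _).2

theorem integrableOn_tail_mono {U : Set (EuclideanSpace ℝ (Fin (n + 1)))}
    {h : EuclideanSpace ℝ (Fin (n + 1)) → ℝ} {R a : ℝ} (hRa : R ≤ a)
    (hh : IntegrableOn h (U ∩ {x | R ≤ ‖x‖})) : IntegrableOn h (U ∩ {x | a ≤ ‖x‖}) :=
  hh.mono_set fun _ hx => ⟨hx.1, hRa.trans hx.2⟩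

/-- The flux of a vector field with integrable divergence through large spheres converges. -/
theorem exists_tendsto_flux {X : Fin (n + 1) → EuclideanSpace ℝ (Fin (n + 1)) → ℝ}
    (hX : ∀ j, ContDiffOn ℝ 1 (X j) (outer Set.univ)) {R : ℝ}
    (hdiv : IntegrableOn (divergence (outer Set.univ) X) (outer Set.univ ∩ {x | R ≤ ‖x‖})) :
    ∃ L, Tendsto (flux (outer Set.univ) X) atTop (𝓝 L) := by
  have hC := isRegularCone_univ (n := n)
  refine exists_tendsto_of_weak_bound (R := max R 1)
    ((hC.continuousOn_flux fun j => (hX j).continuousOn).mono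
      (Set.Ioi_subset_Ioi (le_max_right _ _)))
    (tendsto_tailIntegral hC.measurableSet_outer hdiv) ?_
  intro a b ha φ hφ h01 h0
  have hc : IsRadialCutoff a b φ := ⟨(le_max_right _ _).trans_lt ha, hφ, h0⟩
  rw [hc.integral_deriv_mul_flux_univ hX, abs_neg]
  exact hc.abs_integral_mul_le h01 hC.measurableSet_outer
    (integrableOn_tail_mono ((le_max_left _ _).trans ha.le) hdiv)

end Tail

theorem IsRadialCutoff.integral_plane {a b : ℝ} {φ : ℝ → ℝ} (hφ : IsRadialCutoff a b φ)
    (h : E2 → ℝ) : ∫ z, φ ‖z‖ * h z = ∫ z in outer (n := 1) Set.univ, φ ‖z‖ * h z := by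
  refine (setIntegral_eq_integral_of_forall_compl_eq_zero fun z hz => ?_).symm
  rw [hφ.eq_zero, zero_mul]
  exact fun h' => hz ⟨Set.mem_univ _, hφ.one_lt.trans_le h'.1⟩

theorem continuous_inPlane : Continuous inPlane := by
  unfold inPlane
  refine (PiLp.continuous_toLp 2 _).comp (continuous_pi fun i => ?_)
  fin_cases i <;> simp <;> fun_prop

/-- The combined flux through large half-spheres and their boundary circles converges if the
divergence in the half-space and the divergence in the boundary plane, corrected by the normal
component, are integrable. -/
theorem exists_tendsto_flux_halfSpace {X : Fin 3 → E3 → ℝ} {Y : Fin 2 → E2 → ℝ}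
    (hX : ∀ j, ContDiffOn ℝ 1 (X j) (outer (n := 2) halfSpace))
    (hY : ∀ j, ContDiffOn ℝ 1 (Y j) (outer (n := 1) Set.univ)) {R : ℝ}
    (hdiv : IntegrableOn (divergence (n := 2) (outer (n := 2) halfSpace) X)
      (outer (n := 2) halfSpace ∩ {x | R ≤ ‖x‖}))
    (hdiv' : IntegrableOn (fun z : E2 => X 2 (inPlane z)
        + divergence (n := 1) (outer (n := 1) Set.univ) Y z)
      (outer (n := 1) Set.univ ∩ {x | R ≤ ‖x‖})) :
    ∃ L, Tendsto (fun ρ => flux (n := 2) (outer (n := 2) halfSpace) X ρ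
      + flux (n := 1) (outer (n := 1) Set.univ) Y ρ) atTop (𝓝 L) := by
  have hC := isRegularCone_halfSpace
  have hC' := isRegularCone_univ (n := 1)
  have hcX := (hC.continuousOn_flux fun j => (hX j).continuousOn)
  have hcY := (hC'.continuousOn_flux fun j => (hY j).continuousOn)
  have hT := (tendsto_tailIntegral hC.measurableSet_outer hdiv).add
    (tendsto_tailIntegral hC'.measurableSet_outer hdiv')
  rw [add_zero] at hT
  refine exists_tendsto_of_weak_bound (R := max R 1)
    ((hcX.add hcY).mono (Set.Ioi_subset_Ioi (le_max_right _ _))) hT ?_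
  intro a b ha φ hφ h01 h0
  have ha1 : 1 < a := (le_max_right _ _).trans_lt ha
  have hc : IsRadialCutoff a b φ := ⟨ha1, hφ, h0⟩
  have hdφ : Continuous (deriv φ) := hφ.continuous_deriv le_rfl
  have hint : ∀ Ψ : ℝ → ℝ, ContinuousOn Ψ (Set.Ioi 1) → Integrable fun r => deriv φ r * Ψ r := by
    intro Ψ hΨ
    rw [← integrableOn_iff_integrable_of_support_subset (s := Set.Icc a b)]
    · exact (hdφ.continuousOn.mul
        (hΨ.mono fun r hr => lt_of_lt_of_le ha1 hr.1)).integrableOn_compact isCompact_Icc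
    · intro r hr
      by_contra hr'
      exact hr (by simp only [hc.deriv_eq_zero hr', zero_mul])
  have hX2 : ContinuousOn (fun z => X 2 (inPlane z)) (outer (n := 1) Set.univ) := by
    refine (hX 2).continuousOn.comp continuous_inPlane.continuousOn fun z hz => ⟨?_, ?_⟩
    · change 0 ≤ inPlane z 2
      rw [inPlane_apply_two]
    · change 1 < ‖inPlane z‖
      rw [norm_inPlane]
      exact hz.2
  have hdY : ContinuousOn (divergence (n := 1) (outer (n := 1) Set.univ) Y)
      (outer (n := 1) Set.univ) := by
    refine continuousOn_finsetSum _ fun j _ => ?_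
    exact ((hY j).continuousOn_fderivWithin hC'.uniqueDiffOn_outer le_rfl).clm_apply
      continuousOn_const
  have hi1 := hC'.integrableOn_radial_mul ha1 hφ.continuous h0 hX2
  have hi2 := hC'.integrableOn_radial_mul ha1 hφ.continuous h0 hdY
  have hsub : outer (n := 1) Set.univ ⊆ Set.univ := Set.subset_univ _
  -- The boundary term from the half-space and the planar divergence are integrated together: only
  -- their sum is assumed integrable.
  have key : ∫ r, deriv φ r * (flux (n := 2) (outer (n := 2) halfSpace) X r
      + flux (n := 1) (outer (n := 1) Set.univ) Y r)
      = - (∫ x in outer (n := 2) halfSpace,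
            φ ‖x‖ * divergence (n := 2) (outer (n := 2) halfSpace) X x)
        - ∫ z in outer (n := 1) Set.univ, φ ‖z‖ * (X 2 (inPlane z)
          + divergence (n := 1) (outer (n := 1) Set.univ) Y z) := by
    simp_rw [mul_add]
    rw [integral_add (hint _ hcX) (hint _ hcY), hc.integral_deriv_mul_flux_halfSpace hX,
      hc.integral_deriv_mul_flux_univ hY, hc.integral_plane,
      integral_add (hi1.mono_set hsub) (hi2.mono_set hsub)]
    ring
  rw [key]
  have b1 := hc.abs_integral_mul_le h01 hC.measurableSet_outer
    (integrableOn_tail_mono ((le_max_left _ _).trans ha.le) hdiv)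
  have b2 := hc.abs_integral_mul_le h01 hC'.measurableSet_outer
    (integrableOn_tail_mono ((le_max_left _ _).trans ha.le) hdiv')
  refine (abs_sub _ _).trans ?_
  rw [abs_neg]
  exact add_le_add b1 b2

/-! ### Functions of polynomial decay -/

section Decay

variable {U : Set E3}

/-- `h = O(|x|^p)` at infinity in `U`. -/
def DecayO (U : Set E3) (p : ℝ) (h : E3 → ℝ) : Prop :=
  h =O[atInfinity U] fun x => ‖x‖ ^ p

theorem eventually_mem_atInfinity : ∀ᶠ x in atInfinity U, x ∈ U :=
  mem_inf_of_right (mem_principal_self U)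

theorem tendsto_norm_atInfinity : Tendsto (fun x : E3 => ‖x‖) (atInfinity U) atTop :=
  tendsto_norm_cobounded_atTop.mono_left inf_le_left

theorem eventually_le_norm_atInfinity (R : ℝ) : ∀ᶠ x in atInfinity U, R ≤ ‖x‖ :=
  tendsto_norm_atInfinity.eventually_ge_atTop R

theorem tendsto_rpow_norm_atInfinity {p : ℝ} (hp : p < 0) :
    Tendsto (fun x : E3 => ‖x‖ ^ p) (atInfinity U) (𝓝 0) := by
  have := (tendsto_rpow_neg_atTop (neg_pos.2 hp)).comp (tendsto_norm_atInfinity (U := U))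
  simpa [Function.comp_def] using this

namespace DecayO

variable {p q : ℝ} {f g : E3 → ℝ}

theorem add (hf : DecayO U p f) (hg : DecayO U p g) : DecayO U p fun x => f x + g x :=
  IsBigO.add hf hg

theorem sub (hf : DecayO U p f) (hg : DecayO U p g) : DecayO U p fun x => f x - g x :=
  IsBigO.sub hf hg

theorem const_mul (c : ℝ) (hf : DecayO U p f) : DecayO U p fun x => c * f x :=
  IsBigO.const_mul_left hf c

theorem sum {ι : Type*} {s : Finset ι} {f : ι → E3 → ℝ} (hf : ∀ i ∈ s, DecayO U p (f i)) :
    DecayO U p fun x => ∑ i ∈ s, f i x :=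
  IsBigO.fun_sum hf

theorem mul (hf : DecayO U p f) (hg : DecayO U q g) : DecayO U (p + q) fun x => f x * g x := by
  refine (IsBigO.mul hf hg).congr' EventuallyEq.rfl ?_
  filter_upwards [eventually_le_norm_atInfinity 1] with x hx
  rw [Real.rpow_add (by linarith)]

theorem mono (hf : DecayO U p f) (hpq : p ≤ q) : DecayO U q f := by
  refine IsBigO.trans hf (IsBigO.of_bound 1 ?_)
  filter_upwards [eventually_le_norm_atInfinity 1] with x hx
  rw [one_mul, Real.norm_of_nonneg (by positivity), Real.norm_of_nonneg (by positivity)]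
  exact Real.rpow_le_rpow_of_exponent_le hx hpq

theorem congr (hf : DecayO U p f) (h : ∀ x ∈ U, f x = g x) : DecayO U p g := by
  refine IsBigO.congr' hf ?_ EventuallyEq.rfl
  filter_upwards [eventually_mem_atInfinity] with x hx using h x hx

theorem congr_eventually (hf : DecayO U p f) (h : ∀ᶠ x in atInfinity U, f x = g x) :
    DecayO U p g :=
  IsBigO.congr' hf h EventuallyEq.rfl

theorem const (c : ℝ) : DecayO U 0 fun _ => c := by
  refine (isBigO_refl (fun _ : E3 => c) _).trans ?_
  simp only [Real.rpow_zero]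
  exact isBigO_const_const _ one_ne_zero _

theorem tendsto_zero (hf : DecayO U p f) (hp : p < 0) : Tendsto f (atInfinity U) (𝓝 0) :=
  IsBigO.trans_tendsto hf (tendsto_rpow_norm_atInfinity hp)

end DecayO

theorem pd_congr {h h' : E3 → ℝ} (heq : ∀ x ∈ U, h x = h' x) {x : E3} (hx : x ∈ U) (k : Fin 3) :
    pd U k h x = pd U k h' x := by
  rw [pd, pd, fderivWithin_congr heq (heq x hx)]

/-! ### Rules for partial derivatives within a set -/

section PartialDerivative

variable {x : E3} {h h' : E3 → ℝ} (k : Fin 3)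

theorem pd_add (hx : UniqueDiffWithinAt ℝ U x) (hh : DifferentiableWithinAt ℝ h U x)
    (hh' : DifferentiableWithinAt ℝ h' U x) :
    pd U k (fun y => h y + h' y) x = pd U k h x + pd U k h' x := by
  simp [pd, fderivWithin_fun_add hx hh hh']

theorem pd_sub (hx : UniqueDiffWithinAt ℝ U x) (hh : DifferentiableWithinAt ℝ h U x)
    (hh' : DifferentiableWithinAt ℝ h' U x) :
    pd U k (fun y => h y - h' y) x = pd U k h x - pd U k h' x := by
  simp [pd, fderivWithin_fun_sub hx hh hh']

theorem pd_mul (hx : UniqueDiffWithinAt ℝ U x) (hh : DifferentiableWithinAt ℝ h U x)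
    (hh' : DifferentiableWithinAt ℝ h' U x) :
    pd U k (fun y => h y * h' y) x = pd U k h x * h' x + h x * pd U k h' x := by
  simp [pd, fderivWithin_fun_mul hx hh hh']
  ring

theorem pd_const_mul (hx : UniqueDiffWithinAt ℝ U x) (c : ℝ)
    (hh : DifferentiableWithinAt ℝ h U x) :
    pd U k (fun y => c * h y) x = c * pd U k h x := by
  simp [pd, fderivWithin_const_mul hx hh]

theorem pd_sum (hx : UniqueDiffWithinAt ℝ U x) {ι : Type*} {s : Finset ι} {h : ι → E3 → ℝ}
    (hh : ∀ i ∈ s, DifferentiableWithinAt ℝ (h i) U x) :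
    pd U k (fun y => ∑ i ∈ s, h i y) x = ∑ i ∈ s, pd U k (h i) x := by
  simp [pd, fderivWithin_fun_sum hx hh]

theorem contDiffOn_pd (hU : UniqueDiffOn ℝ U) (hh : ContDiffOn ℝ ∞ h U) :
    ContDiffOn ℝ ∞ (pd U k h) U :=
  (hh.fderivWithin hU (m := ∞) (by simp)).clm_apply contDiffOn_const

end PartialDerivative

/-! ### Decay under composition with a differentiable function -/

section Composition

variable {ι : Type*} {h : E3 → ι → ℝ} {c : ι → ℝ} {Θ : (ι → ℝ) → ℝ} {q : ℝ}

theorem tendsto_of_decayO (hq : 0 < q) (h0 : ∀ i, DecayO U (-q) fun x => h x i - c i) :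
    Tendsto h (atInfinity U) (𝓝 c) := by
  rw [tendsto_pi_nhds]
  intro i
  have := ((h0 i).tendsto_zero (by linarith)).add_const (c i)
  simpa using this

/-- Differentiability at the limit value gives `Θ (h x) - Θ c = O(h x - c)`. -/
theorem decayO_comp_sub [Fintype ι] (hΘ : ContDiffAt ℝ 1 Θ c) (hq : 0 < q)
    (h0 : ∀ i, DecayO U (-q) fun x => h x i - c i) :
    DecayO U (-q) fun x => Θ (h x) - Θ c := by
  have h1 := (hΘ.differentiableAt one_ne_zero).isBigO_sub.comp_tendsto (tendsto_of_decayO hq h0)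
  refine IsBigO.trans h1 ?_
  rw [isBigO_pi]
  exact h0

/-- Chain rule: the derivative of `Θ` stays bounded along `h x → c`, so the rate is that of the
derivatives of `h`. -/
theorem decayO_pd_comp [Fintype ι] (hU : UniqueDiffOn ℝ U) (hΘ : ContDiffAt ℝ 1 Θ c) (hq : 0 < q)
    (h0 : ∀ i, DecayO U (-q) fun x => h x i - c i) (k : Fin 3)
    (h1 : ∀ i, DecayO U (-q - 1) (pd U k fun x => h x i))
    (hd : ∀ i, ∀ x ∈ U, DifferentiableWithinAt ℝ (fun x => h x i) U x) :
    DecayO U (-q - 1) (pd U k fun x => Θ (h x)) := by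
  have ht := tendsto_of_decayO hq h0
  have hΘd : ∀ᶠ y in 𝓝 c, DifferentiableAt ℝ Θ y :=
    (hΘ.eventually (by simp)).mono fun y hy => hy.differentiableAt one_ne_zero
  have hcont : ContinuousAt (fun y => fderiv ℝ Θ y) c :=
    (hΘ.fderiv_right (m := 0) (by simp)).continuousAt
  have hb : (fun x => fderiv ℝ Θ (h x)) =O[atInfinity U] fun _ => (1 : ℝ) :=
    (hcont.tendsto.comp ht).isBigO_one ℝ
  have hv : (fun x i => pd U k (fun x => h x i) x) =O[atInfinity U]
      fun x => ‖x‖ ^ (-q - 1) := isBigO_pi.2 h1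
  have hprod : (fun x => fderiv ℝ Θ (h x) fun i => pd U k (fun x => h x i) x)
      =O[atInfinity U] fun x => ‖x‖ ^ (-q - 1) := by
    refine (IsBigO.of_bound 1 (Eventually.of_forall fun x => ?_)).trans
      ((hb.norm_left.mul hv.norm_left).congr_right fun x => by rw [one_mul])
    rw [one_mul, norm_mul, norm_norm, norm_norm]
    exact (fderiv ℝ Θ (h x)).le_opNorm _
  refine IsBigO.congr' hprod ?_ EventuallyEq.rfl
  filter_upwards [eventually_mem_atInfinity, ht.eventually hΘd] with x hx hΘx
  have hdx : HasFDerivWithinAt h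
      (ContinuousLinearMap.pi fun i => fderivWithin ℝ (fun x => h x i) U x) U x :=
    hasFDerivWithinAt_pi.2 fun i => (hd i x hx).hasFDerivWithinAt
  have := (hΘx.hasFDerivAt.comp_hasFDerivWithinAt x hdx).fderivWithin (hU x hx)
  rw [pd]
  change _ = fderivWithin ℝ (Θ ∘ h) U x _
  rw [this]
  rfl

end Composition

/-! ### Smooth dependence of determinants and inverses -/

section Matrix

variable {E : Type*} [NormedAddCommGroup E] [NormedSpace ℝ E] {m : Type*} [Fintype m]
  [DecidableEq m] {A : E → Matrix m m ℝ} {s : Set E} {x : E} {k : WithTop ℕ∞}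

theorem contDiffWithinAt_det (hA : ∀ i j, ContDiffWithinAt ℝ k (fun y => A y i j) s x) :
    ContDiffWithinAt ℝ k (fun y => (A y).det) s x := by
  simp only [Matrix.det_apply]
  refine ContDiffWithinAt.sum fun σ _ => ?_
  refine ContDiffWithinAt.const_smul _ ?_
  exact contDiffWithinAt_prod fun i _ => hA _ _

/-- By Cramer's rule each entry of the inverse is a quotient of determinants. -/
theorem contDiffWithinAt_inv (hA : ∀ i j, ContDiffWithinAt ℝ k (fun y => A y i j) s x)
    (h0 : (A x).det ≠ 0) (i j : m) : ContDiffWithinAt ℝ k (fun y => (A y)⁻¹ i j) s x := by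
  simp only [Matrix.inv_def, Matrix.smul_apply, Ring.inverse_eq_inv', smul_eq_mul,
    Matrix.adjugate_apply]
  refine ((contDiffWithinAt_det hA).inv h0).mul (contDiffWithinAt_det fun a b => ?_)
  by_cases h : a = j
  · subst h
    simp only [Matrix.updateRow_self]
    exact contDiffWithinAt_const
  · simp only [Matrix.updateRow_ne h]
    exact hA a b

end Matrix

end Decay

/-! ### Curvature of asymptotically flat metrics -/

section Curvature

variable {U : Set E3} {G : E3 → Matrix (Fin 3) (Fin 3) ℝ} {q : ℝ}

/-- The components of `G` are smooth on `U`, and `G` is symmetric there, with positive determinant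
and positive diagonal. -/
structure IsSmoothMetric (U : Set E3) (G : E3 → Matrix (Fin 3) (Fin 3) ℝ) : Prop where
  uniqueDiffOn : UniqueDiffOn ℝ U
  contDiffOn : ∀ i j, ContDiffOn ℝ ∞ (fun x => G x i j) U
  det_pos : ∀ x ∈ U, 0 < (G x).det
  diag_pos : ∀ x ∈ U, ∀ i, 0 < G x i i
  symm : ∀ x ∈ U, ∀ i j, G x i j = G x j i

/-- Decay of the metric to the Euclidean one at a given rate `q`. -/
structure DecaysAtRate (U : Set E3) (q : ℝ) (G : E3 → Matrix (Fin 3) (Fin 3) ℝ) : Prop where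
  half_lt : 1 / 2 < q
  sub_one : ∀ i j, DecayO U (-q) fun x => G x i j - (1 : Matrix (Fin 3) (Fin 3) ℝ) i j
  decayO_pd : ∀ k i j, DecayO U (-q - 1) (pd U k fun x => G x i j)
  decayO_pd_pd : ∀ l k i j, DecayO U (-q - 2) (pd U l (pd U k fun x => G x i j))

theorem DecaysAtRate.mono {q' : ℝ} (h : DecaysAtRate U q G) (hq' : 1 / 2 < q') (hle : q' ≤ q) :
    DecaysAtRate U q' G where
  half_lt := hq'
  sub_one i j := (h.sub_one i j).mono (by linarith)
  decayO_pd k i j := (h.decayO_pd k i j).mono (by linarith)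
  decayO_pd_pd l k i j := (h.decayO_pd_pd l k i j).mono (by linarith)

theorem DecaysToEuclidean.exists_decaysAtRate (h : DecaysToEuclidean U G) :
    ∃ q, DecaysAtRate U q G := by
  obtain ⟨q, hq, -, h⟩ := h
  exact ⟨q, hq, fun i j => (h i j).1, fun k i j => (h i j).2.1 k,
    fun l k i j => (h i j).2.2 k l⟩

section Functions

/-- The matrix with entries `w`. -/
def toMatrix (w : Fin 3 × Fin 3 → ℝ) : Matrix (Fin 3) (Fin 3) ℝ := Matrix.of fun i j => w (i, j)

/-- Handles the inverse metric, the volume density and the weights of the mean curvature alike: each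
is a function of the metric matrix that is smooth near the identity. -/
theorem DecaysAtRate.comp_sub (h : DecaysAtRate U q G) {Θ : Matrix (Fin 3) (Fin 3) ℝ → ℝ}
    (hΘ : ContDiffAt ℝ 1 (fun w => Θ (toMatrix w))
      (fun p => (1 : Matrix (Fin 3) (Fin 3) ℝ) p.1 p.2)) :
    DecayO U (-q) fun x => Θ (G x) - Θ 1 :=
  decayO_comp_sub (h := fun x (p : Fin 3 × Fin 3) => G x p.1 p.2) hΘ (by linarith [h.half_lt])
    fun p => h.sub_one p.1 p.2

theorem DecaysAtRate.pd_comp (h : DecaysAtRate U q G) (hG : IsSmoothMetric U G)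
    {Θ : Matrix (Fin 3) (Fin 3) ℝ → ℝ}
    (hΘ : ContDiffAt ℝ 1 (fun w => Θ (toMatrix w))
      (fun p => (1 : Matrix (Fin 3) (Fin 3) ℝ) p.1 p.2)) (k : Fin 3) :
    DecayO U (-q - 1) (pd U k fun x => Θ (G x)) :=
  decayO_pd_comp (h := fun x (p : Fin 3 × Fin 3) => G x p.1 p.2) hG.uniqueDiffOn hΘ
    (by linarith [h.half_lt]) (fun p => h.sub_one p.1 p.2) k (fun p => h.decayO_pd k p.1 p.2)
    fun p x hx => (hG.contDiffOn p.1 p.2 x hx).differentiableWithinAt (by simp)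

theorem toMatrix_one : toMatrix (fun p => (1 : Matrix (Fin 3) (Fin 3) ℝ) p.1 p.2) = 1 := rfl

theorem contDiffAt_toMatrix_apply (i j : Fin 3) (w : Fin 3 × Fin 3 → ℝ) {k : WithTop ℕ∞} :
    ContDiffAt ℝ k (fun w => toMatrix w i j) w := by
  change ContDiffAt ℝ k (fun w : Fin 3 × Fin 3 → ℝ => w (i, j)) w
  fun_prop

theorem contDiffAt_inv_toMatrix (i j : Fin 3) :
    ContDiffAt ℝ 1 (fun w => (toMatrix w)⁻¹ i j)
      (fun p => (1 : Matrix (Fin 3) (Fin 3) ℝ) p.1 p.2) := by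
  rw [← contDiffWithinAt_univ]
  refine contDiffWithinAt_inv (fun a b => (contDiffAt_toMatrix_apply a b _).contDiffWithinAt) ?_ i j
  rw [toMatrix_one]
  simp

theorem contDiffAt_volumeDensity_toMatrix :
    ContDiffAt ℝ 1 (fun w => √(toMatrix w).det)
      (fun p => (1 : Matrix (Fin 3) (Fin 3) ℝ) p.1 p.2) := by
  refine ContDiffAt.sqrt ?_ (by rw [toMatrix_one]; simp)
  rw [← contDiffWithinAt_univ]
  exact contDiffWithinAt_det fun a b => (contDiffAt_toMatrix_apply a b _).contDiffWithinAt

end Functions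

theorem IsSmoothMetric.contDiffOn_inv (hG : IsSmoothMetric U G) (i j : Fin 3) :
    ContDiffOn ℝ ∞ (fun x => (G x)⁻¹ i j) U := fun x hx =>
  contDiffWithinAt_inv (fun a b => hG.contDiffOn a b x hx) (hG.det_pos x hx).ne' i j

theorem IsSmoothMetric.contDiffOn_volumeDensity (hG : IsSmoothMetric U G) :
    ContDiffOn ℝ ∞ (volumeDensity G) U := fun x hx =>
  (contDiffWithinAt_det (fun a b => hG.contDiffOn a b x hx)).sqrt (hG.det_pos x hx).ne'

theorem IsSmoothMetric.contDiffOn_pd (hG : IsSmoothMetric U G) (k i j : Fin 3) :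
    ContDiffOn ℝ ∞ (pd U k fun x => G x i j) U :=
  ConformalMass.contDiffOn_pd k hG.uniqueDiffOn (hG.contDiffOn i j)

theorem DecaysAtRate.inv_sub_one (h : DecaysAtRate U q G) (i j : Fin 3) :
    DecayO U (-q) fun x => (G x)⁻¹ i j - (1 : Matrix (Fin 3) (Fin 3) ℝ) i j := by
  have := h.comp_sub (Θ := fun A => A⁻¹ i j) (contDiffAt_inv_toMatrix i j)
  simpa using this

theorem DecaysAtRate.volumeDensity_sub_one (h : DecaysAtRate U q G) :
    DecayO U (-q) fun x => volumeDensity G x - 1 := by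
  have := h.comp_sub (Θ := fun A => √A.det) contDiffAt_volumeDensity_toMatrix
  simpa [volumeDensity] using this

theorem DecayO.of_sub_const {f : E3 → ℝ} {c : ℝ} (hq : 0 ≤ q)
    (h : DecayO U (-q) fun x => f x - c) : DecayO U 0 f :=
  ((h.mono (by linarith)).add (DecayO.const c)).congr fun x _ => by ring

/-- The lowered Christoffel symbols `∂_i g_jl + ∂_j g_il - ∂_l g_ij` (without the factor `½`). -/
noncomputable def lowered (U : Set E3) (G : E3 → Matrix (Fin 3) (Fin 3) ℝ) (i j l : Fin 3)
    (x : E3) : ℝ :=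
  pd U i (fun y => G y j l) x + pd U j (fun y => G y i l) x - pd U l (fun y => G y i j) x

theorem IsSmoothMetric.contDiffOn_lowered (hG : IsSmoothMetric U G) (i j l : Fin 3) :
    ContDiffOn ℝ ∞ (lowered U G i j l) U :=
  ((hG.contDiffOn_pd i j l).add (hG.contDiffOn_pd j i l)).sub (hG.contDiffOn_pd l i j)

theorem DecaysAtRate.decayO_lowered (h : DecaysAtRate U q G) (i j l : Fin 3) :
    DecayO U (-q - 1) (lowered U G i j l) :=
  ((h.decayO_pd i j l).add (h.decayO_pd j i l)).sub (h.decayO_pd l i j)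

theorem IsSmoothMetric.pd_lowered (hG : IsSmoothMetric U G) (m i j l : Fin 3) {x : E3}
    (hx : x ∈ U) :
    pd U m (lowered U G i j l) x
      = pd U m (pd U i fun y => G y j l) x + pd U m (pd U j fun y => G y i l) x
        - pd U m (pd U l fun y => G y i j) x := by
  have hd : ∀ k i j, DifferentiableWithinAt ℝ (pd U k fun y => G y i j) U x := fun k i j =>
    (hG.contDiffOn_pd k i j x hx).differentiableWithinAt (by simp)
  unfold lowered
  rw [pd_sub m (hG.uniqueDiffOn x hx) ((hd _ _ _).fun_add (hd _ _ _)) (hd _ _ _),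
    pd_add m (hG.uniqueDiffOn x hx) (hd _ _ _) (hd _ _ _)]

theorem DecaysAtRate.decayO_pd_lowered (h : DecaysAtRate U q G) (hG : IsSmoothMetric U G)
    (m i j l : Fin 3) : DecayO U (-q - 2) (pd U m (lowered U G i j l)) :=
  (((h.decayO_pd_pd m i j l).add (h.decayO_pd_pd m j i l)).sub (h.decayO_pd_pd m l i j)).congr
    fun _ hx => (hG.pd_lowered m i j l hx).symm

theorem christoffel_eq (k i j : Fin 3) (x : E3) :
    christoffel U G k i j x = 1 / 2 * ∑ l, (G x)⁻¹ k l * lowered U G i j l x := rfl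

theorem sum_one_mul (k : Fin 3) (v : Fin 3 → ℝ) :
    ∑ l, (1 : Matrix (Fin 3) (Fin 3) ℝ) k l * v l = v k := by
  simp [Matrix.one_apply]

/-- Replacing `g^kl` by `δ^kl` costs a product of `O(r^(-q))` and `O(r^(-q-1))`. The same quadratic
gain drives the estimates below for derivatives, Ricci and scalar curvature. -/
theorem DecaysAtRate.christoffel_sub (h : DecaysAtRate U q G) (k i j : Fin 3) :
    DecayO U (-2 * q - 1) fun x =>
      christoffel U G k i j x - 1 / 2 * lowered U G i j k x := by
  have h1 : DecayO U (-2 * q - 1) fun x => 1 / 2 * ∑ l,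
      ((G x)⁻¹ k l - (1 : Matrix (Fin 3) (Fin 3) ℝ) k l) * lowered U G i j l x :=
    DecayO.const_mul _ (DecayO.sum fun l _ =>
      ((h.inv_sub_one k l).mul (h.decayO_lowered i j l)).mono (by linarith))
  refine h1.congr fun x _ => ?_
  simp only [sub_mul, Finset.sum_sub_distrib, sum_one_mul, christoffel_eq]
  ring

theorem DecaysAtRate.decayO_christoffel (h : DecaysAtRate U q G) (k i j : Fin 3) :
    DecayO U (-q - 1) (christoffel U G k i j) :=
  (((h.christoffel_sub k i j).mono (by linarith [h.half_lt])).add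
    ((h.decayO_lowered i j k).const_mul (1 / 2))).congr fun x _ => by ring

theorem DecaysAtRate.pd_christoffel_sub (h : DecaysAtRate U q G) (hG : IsSmoothMetric U G)
    (m k i j : Fin 3) :
    DecayO U (-2 * q - 2) fun x => pd U m (christoffel U G k i j) x
      - 1 / 2 * pd U m (lowered U G i j k) x := by
  have h1 : DecayO U (-2 * q - 2) fun x => 1 / 2 * ∑ l,
      (pd U m (fun y => (G y)⁻¹ k l) x * lowered U G i j l x
        + ((G x)⁻¹ k l - (1 : Matrix (Fin 3) (Fin 3) ℝ) k l)
          * pd U m (lowered U G i j l) x) := by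
    refine DecayO.const_mul _ (DecayO.sum fun l _ => DecayO.add ?_ ?_)
    · exact ((h.pd_comp hG (Θ := fun A => A⁻¹ k l) (contDiffAt_inv_toMatrix k l) m).mul
        (h.decayO_lowered i j l)).mono (by linarith)
    · exact ((h.inv_sub_one k l).mul (h.decayO_pd_lowered hG m i j l)).mono (by linarith)
  refine h1.congr fun x hx => ?_
  have hu := hG.uniqueDiffOn x hx
  have hd1 : ∀ l, DifferentiableWithinAt ℝ (fun y => (G y)⁻¹ k l) U x := fun l =>
    (hG.contDiffOn_inv k l x hx).differentiableWithinAt (by simp)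
  have hd2 : ∀ l, DifferentiableWithinAt ℝ (lowered U G i j l) U x := fun l =>
    (hG.contDiffOn_lowered i j l x hx).differentiableWithinAt (by simp)
  have h2 : pd U m (christoffel U G k i j) x
      = 1 / 2 * ∑ l, (pd U m (fun y => (G y)⁻¹ k l) x
        * lowered U G i j l x
        + (G x)⁻¹ k l * pd U m (lowered U G i j l) x) := by
    have : christoffel U G k i j
        = fun x => 1 / 2 * ∑ l, (G x)⁻¹ k l * lowered U G i j l x :=
      funext (christoffel_eq k i j)
    rw [this, pd_const_mul m hu _
      (DifferentiableWithinAt.fun_sum fun l _ => (hd1 l).fun_mul (hd2 l)),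
      pd_sum m hu fun l _ => (hd1 l).fun_mul (hd2 l)]
    congr 1
    exact Finset.sum_congr rfl fun l _ => pd_mul m hu (hd1 l) (hd2 l)
  rw [h2]
  simp only [sub_mul, Finset.sum_sub_distrib, Finset.sum_add_distrib, sum_one_mul]
  ring

/-- The part of the Ricci curvature that is linear in the second derivatives of the metric. -/
noncomputable def linearRicci (U : Set E3) (G : E3 → Matrix (Fin 3) (Fin 3) ℝ) (i j : Fin 3)
    (x : E3) : ℝ :=
  ∑ k, (1 / 2 * pd U k (lowered U G i j k) x - 1 / 2 * pd U j (lowered U G i k k) x)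

/-- The `ΓΓ` terms are quadratic, hence of order `r^(-2q-2)`, as are the errors from linearising
`∂Γ`. -/
theorem DecaysAtRate.ricci_sub (h : DecaysAtRate U q G) (hG : IsSmoothMetric U G)
    (i j : Fin 3) :
    DecayO U (-2 * q - 2) fun x => ricci U G i j x - linearRicci U G i j x := by
  have h1 : DecayO U (-2 * q - 2) fun x =>
      ∑ k, ((pd U k (christoffel U G k i j) x
          - 1 / 2 * pd U k (lowered U G i j k) x)
        - (pd U j (christoffel U G k i k) x
          - 1 / 2 * pd U j (lowered U G i k k) x))
      + ∑ k, ∑ l, (christoffel U G k k l x * christoffel U G l i j x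
        - christoffel U G k j l x * christoffel U G l i k x) := by
    refine DecayO.add (DecayO.sum fun k _ =>
      (h.pd_christoffel_sub hG k k i j).sub (h.pd_christoffel_sub hG j k i k))
      (DecayO.sum fun k _ => DecayO.sum fun l _ => DecayO.sub ?_ ?_)
    · exact ((h.decayO_christoffel k k l).mul (h.decayO_christoffel l i j)).mono (by linarith)
    · exact ((h.decayO_christoffel k j l).mul (h.decayO_christoffel l i k)).mono (by linarith)
  refine h1.congr fun x _ => ?_
  simp only [ricci, linearRicci, Finset.sum_sub_distrib]
  ring

theorem DecaysAtRate.decayO_linearRicci (h : DecaysAtRate U q G) (hG : IsSmoothMetric U G)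
    (i j : Fin 3) : DecayO U (-q - 2) (linearRicci U G i j) :=
  DecayO.sum fun k _ => ((h.decayO_pd_lowered hG k i j k).const_mul _).sub
    ((h.decayO_pd_lowered hG j i k k).const_mul _)

theorem DecaysAtRate.decayO_ricci (h : DecaysAtRate U q G) (hG : IsSmoothMetric U G)
    (i j : Fin 3) : DecayO U (-q - 2) (ricci U G i j) :=
  (((h.ricci_sub hG i j).mono (by linarith [h.half_lt])).add (h.decayO_linearRicci hG i j)).congr
    fun x _ => by ring

theorem DecaysAtRate.scalarCurvature_sub (h : DecaysAtRate U q G) (hG : IsSmoothMetric U G) :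
    DecayO U (-2 * q - 2) fun x =>
      scalarCurvature U G x - ∑ i, linearRicci U G i i x := by
  have h1 : DecayO U (-2 * q - 2) fun x =>
      ∑ i, ((∑ j, ((G x)⁻¹ i j - (1 : Matrix (Fin 3) (Fin 3) ℝ) i j) * ricci U G i j x)
        + (ricci U G i i x - linearRicci U G i i x)) :=
    DecayO.sum fun i _ => (DecayO.sum fun j _ =>
      ((h.inv_sub_one i j).mul (h.decayO_ricci hG i j)).mono (by linarith)).add (h.ricci_sub hG i i)
  refine h1.congr fun x _ => ?_
  simp only [sub_mul, Finset.sum_sub_distrib, Finset.sum_add_distrib, sum_one_mul, scalarCurvature]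
  ring

theorem IsSmoothMetric.contDiffOn_massForm (hG : IsSmoothMetric U G) (j : Fin 3) :
    ContDiffOn ℝ ∞ (massForm U G j) U :=
  ContDiffOn.sum fun i _ => (hG.contDiffOn_pd i i j).sub (hG.contDiffOn_pd j i i)

/-- Both sides are `∑ (∂_j ∂_i g_ij - ∂_j ∂_j g_ii)`. This is the reason for the form of the mass
integrand. -/
theorem IsSmoothMetric.divergence_massForm (hG : IsSmoothMetric U G) {x : E3} (hx : x ∈ U) :
    divergence (n := 2) U (massForm U G) x = ∑ i, linearRicci U G i i x := by
  have hd : ∀ k i j, DifferentiableWithinAt ℝ (pd U k fun y => G y i j) U x := fun k i j =>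
    (hG.contDiffOn_pd k i j x hx).differentiableWithinAt (by simp)
  have h1 : ∀ j, pd U j (massForm U G j) x
      = ∑ i, (pd U j (pd U i fun y => G y i j) x - pd U j (pd U j fun y => G y i i) x) := by
    intro j
    unfold massForm
    rw [pd_sum j (hG.uniqueDiffOn x hx) fun i _ => (hd i i j).fun_sub (hd j i i)]
    exact Finset.sum_congr rfl fun i _ => pd_sub j (hG.uniqueDiffOn x hx) (hd i i j) (hd j i i)
  change ∑ j, pd U j (massForm U G j) x = _
  -- The terms match without commuting derivatives or using the symmetry of `G`.
  simp only [h1, linearRicci, hG.pd_lowered _ _ _ _ hx, Fin.sum_univ_three]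
  ring

/-- The linear part is `O(r^(-q-2))`, so inserting the density, which is `1 + O(r^(-q))`, changes it
only at quadratic order. -/
theorem DecaysAtRate.scalarCurvature_density_sub (h : DecaysAtRate U q G)
    (hG : IsSmoothMetric U G) :
    DecayO U (-2 * q - 2) fun x => divergence (n := 2) U (massForm U G) x
      - scalarCurvature U G x * volumeDensity G x := by
  have hq := h.half_lt
  have hL : DecayO U (-q - 2) fun x => ∑ i, linearRicci U G i i x :=
    DecayO.sum fun i _ => h.decayO_linearRicci hG i i
  have h1 := (h.scalarCurvature_sub hG).mul
    (DecayO.of_sub_const (by linarith) h.volumeDensity_sub_one)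
  have h2 := hL.mul h.volumeDensity_sub_one
  refine (((h1.mono (q := -2 * q - 2) (by linarith)).add (h2.mono (by linarith))).const_mul
    (-1)).congr fun x hx => ?_
  rw [hG.divergence_massForm hx]
  ring

end Curvature

/-! ### Integrability from decay -/

section Integrability

variable {n : ℕ}

theorem exists_integrableOn_of_isBigO {U : Set (EuclideanSpace ℝ (Fin (n + 1)))}
    (hU : MeasurableSet U) {h : EuclideanSpace ℝ (Fin (n + 1)) → ℝ} {p : ℝ} (hp : p < -(n + 1))
    (hm : AEStronglyMeasurable h (volume.restrict U))
    (hh : h =O[Bornology.cobounded (EuclideanSpace ℝ (Fin (n + 1))) ⊓ 𝓟 U] fun x => ‖x‖ ^ p) :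
    ∃ R : ℝ, IntegrableOn h (U ∩ {x | R ≤ ‖x‖}) := by
  obtain ⟨c, hc⟩ := hh.bound
  rw [eventually_inf_principal, ← comap_norm_atTop, eventually_comap] at hc
  obtain ⟨R, hR⟩ := eventually_atTop.1 hc
  refine ⟨max R 1, ?_⟩
  -- For `‖x‖ ≥ 1` one has `(1 + ‖x‖) / 2 ≤ ‖x‖`; the exponent `p` is negative, whence the factor
  -- `(1 / 2) ^ p`.
  have hint : Integrable fun x : EuclideanSpace ℝ (Fin (n + 1)) =>
      |c| * ((1 / 2) ^ p * (1 + ‖x‖) ^ p) := by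
    have := integrable_one_add_norm (E := EuclideanSpace ℝ (Fin (n + 1))) (μ := volume)
      (r := -p) (by simp; linarith)
    simp only [neg_neg] at this
    exact (this.const_mul _).const_mul _
  refine Integrable.mono' (hint.integrableOn (s := U ∩ {x | max R 1 ≤ ‖x‖}))
    (hm.mono_measure (Measure.restrict_mono Set.inter_subset_left le_rfl)) ?_
  filter_upwards [ae_restrict_mem (hU.inter (measurableSet_le_norm _))] with x hx
  have h1 : 1 ≤ ‖x‖ := (le_max_right _ _).trans hx.2
  refine (hR ‖x‖ ((le_max_left _ _).trans hx.2) x rfl hx.1).trans ?_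
  rw [Real.norm_of_nonneg (by positivity)]
  refine (mul_le_mul_of_nonneg_right (le_abs_self c) (by positivity)).trans ?_
  refine mul_le_mul_of_nonneg_left ?_ (abs_nonneg c)
  rw [← Real.mul_rpow (by norm_num) (by positivity)]
  exact Real.rpow_le_rpow_of_nonpos (by positivity) (by linarith) (by linarith)

/-- A function that differs from an integrable one by a term of sufficient decay is integrable far
out. -/
theorem exists_integrableOn_of_isBigO_sub {U : Set (EuclideanSpace ℝ (Fin (n + 1)))}
    (hU : MeasurableSet U) {h k : EuclideanSpace ℝ (Fin (n + 1)) → ℝ} {p : ℝ}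
    (hp : p < -(n + 1)) (hh : ContinuousOn h U) (hk : IntegrableOn k U)
    (hhk : (fun x => h x - k x) =O[Bornology.cobounded (EuclideanSpace ℝ (Fin (n + 1))) ⊓ 𝓟 U]
      fun x => ‖x‖ ^ p) :
    ∃ R : ℝ, IntegrableOn h (U ∩ {x | R ≤ ‖x‖}) := by
  obtain ⟨R, hR⟩ := exists_integrableOn_of_isBigO hU hp
    ((hh.aestronglyMeasurable hU).sub hk.aestronglyMeasurable) hhk
  refine ⟨R, ?_⟩
  refine (hR.add (hk.mono_set Set.inter_subset_left)).congr_fun_ae ?_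
  exact Eventually.of_forall fun x => by simp

end Integrability

/-! ### The mean curvature of the boundary plane -/

section MeanCurvature

variable {U : Set E3} {G : E3 → Matrix (Fin 3) (Fin 3) ℝ} {q : ℝ}

/-- The coefficients of the Christoffel symbols in the mean curvature density. -/
noncomputable def boundaryWeight (α β : Fin 2) (A : Matrix (Fin 3) (Fin 3) ℝ) : ℝ :=
  (A.submatrix Fin.castSucc Fin.castSucc)⁻¹ α β *
    √(A.submatrix (Fin.castSucc : Fin 2 → Fin 3) Fin.castSucc).det / √(A⁻¹ 2 2)

theorem meanCurvature_mul_eq (z : E2) :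
    meanCurvature U G z * √(inducedMetric G z).det
      = ∑ α : Fin 2, ∑ β : Fin 2, boundaryWeight α β (G (inPlane z)) *
        christoffel U G 2 α.castSucc β.castSucc (inPlane z) := by
  rw [meanCurvature, Finset.sum_mul]
  refine Finset.sum_congr rfl fun α _ => ?_
  rw [Finset.sum_mul]
  refine Finset.sum_congr rfl fun β _ => ?_
  simp only [boundaryWeight, inducedMetric]
  ring

theorem submatrix_one_castSucc :
    (1 : Matrix (Fin 3) (Fin 3) ℝ).submatrix (Fin.castSucc : Fin 2 → Fin 3) Fin.castSucc = 1 :=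
  Matrix.submatrix_one _ (Fin.castSucc_injective 2)

theorem boundaryWeight_one (α β : Fin 2) :
    boundaryWeight α β 1 = (1 : Matrix (Fin 2) (Fin 2) ℝ) α β := by
  simp [boundaryWeight, submatrix_one_castSucc]

theorem contDiffAt_boundaryWeight (α β : Fin 2) :
    ContDiffAt ℝ 1 (fun w => boundaryWeight α β (toMatrix w))
      (fun p => (1 : Matrix (Fin 3) (Fin 3) ℝ) p.1 p.2) := by
  have hsub : ∀ a b : Fin 2, ContDiffWithinAt ℝ 1
      (fun w => (toMatrix w).submatrix (Fin.castSucc : Fin 2 → Fin 3) Fin.castSucc a b) Set.univ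
      (fun p => (1 : Matrix (Fin 3) (Fin 3) ℝ) p.1 p.2) := fun a b =>
    (contDiffAt_toMatrix_apply a.castSucc b.castSucc _).contDiffWithinAt
  unfold boundaryWeight
  refine ContDiffAt.div (ContDiffAt.mul ?_ (ContDiffAt.sqrt ?_ ?_))
    (ContDiffAt.sqrt (contDiffAt_inv_toMatrix 2 2) ?_) ?_
  · rw [← contDiffWithinAt_univ]
    refine contDiffWithinAt_inv hsub ?_ α β
    rw [toMatrix_one, submatrix_one_castSucc]
    simp
  · rw [← contDiffWithinAt_univ]
    exact contDiffWithinAt_det hsub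
  · rw [toMatrix_one, submatrix_one_castSucc]
    simp
  · rw [toMatrix_one]
    simp
  · rw [toMatrix_one]
    simp

/-- The first bracket is exactly `∑_α (2 ∂_α g_α3 - ∂_3 g_αα)`, the sum of the lowered symbols with
indices `α, α, 3`. To leading order this is `2 ∑_α Γ^3_αα`, i.e. twice the mean curvature density,
whose weights tend to `δ_αβ`. -/
theorem DecaysAtRate.boundary_sub (h : DecaysAtRate U q G) (hG : IsSmoothMetric U G) :
    DecayO U (-2 * q - 1) fun x =>
      (massForm U G 2 x + ∑ α : Fin 2, pd U α.castSucc (fun y => G y 2 α.castSucc) x)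
        - 2 * ∑ α : Fin 2, ∑ β : Fin 2, boundaryWeight α β (G x) *
          christoffel U G 2 α.castSucc β.castSucc x := by
  have h1 : DecayO U (-2 * q - 1) fun x => (-2) * ∑ α : Fin 2,
      ((∑ β : Fin 2, (boundaryWeight α β (G x) - boundaryWeight α β 1) *
          christoffel U G 2 α.castSucc β.castSucc x)
        + (christoffel U G 2 α.castSucc α.castSucc x
          - 1 / 2 * lowered U G α.castSucc α.castSucc 2 x)) := by
    refine DecayO.const_mul _ (DecayO.sum fun α _ => DecayO.add (DecayO.sum fun β _ => ?_)
      (h.christoffel_sub _ _ _))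
    exact ((h.comp_sub (contDiffAt_boundaryWeight α β)).mul
      (h.decayO_christoffel _ _ _)).mono (by linarith)
  refine h1.congr fun x hx => ?_
  have hs : ∀ k i j, pd U k (fun y => G y i j) x = pd U k (fun y => G y j i) x := fun k i j =>
    pd_congr (fun y hy => hG.symm y hy i j) hx k
  simp only [boundaryWeight_one, lowered, massForm, Fin.sum_univ_three, Fin.sum_univ_two,
    Matrix.one_apply]
  have c0 : Fin.castSucc (0 : Fin 2) = (0 : Fin 3) := rfl
  have c1 : Fin.castSucc (1 : Fin 2) = (1 : Fin 3) := rfl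
  simp only [c0, c1, hs 0 2 0, hs 1 2 1]
  simp
  ring

end MeanCurvature

/-! ### Existence of the masses -/

theorem massFlux_eq_flux (U : Set E3) (G : E3 → Matrix (Fin 3) (Fin 3) ℝ) :
    massFlux U G = flux (n := 2) U (massForm U G) := rfl

/-- The flux of the mass form of an asymptotically flat metric with integrable scalar curvature
converges. -/
theorem exists_tendsto_massFlux {G : E3 → Matrix (Fin 3) (Fin 3) ℝ} {q : ℝ}
    (hG : IsSmoothMetric exterior G) (hq : DecaysAtRate exterior q G)
    (hR : IntegrableForVolume exterior G (scalarCurvature exterior G)) :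
    ∃ L, Tendsto (massFlux exterior G) atTop (𝓝 L) := by
  rw [massFlux_eq_flux]
  have hC := isRegularCone_univ (n := 2)
  have hm := hC.measurableSet_outer
  have hX := hG.contDiffOn_massForm
  have hd := hq.scalarCurvature_density_sub hG
  rw [← outer_univ_eq_exterior] at *
  have hc : ContinuousOn (divergence (n := 2) (outer (n := 2) Set.univ)
      (massForm (outer (n := 2) Set.univ) G)) (outer (n := 2) Set.univ) := by
    refine continuousOn_finsetSum _ fun j _ => ?_
    exact ((hX j).continuousOn_fderivWithin hC.uniqueDiffOn_outer (by simp)).clm_apply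
      continuousOn_const
  -- Here `q > 1/2` gives `-2q - 2 < -3`, integrability in dimension three.
  obtain ⟨R, hR'⟩ := exists_integrableOn_of_isBigO_sub hm (p := -2 * q - 2)
    (by push_cast; linarith [hq.half_lt]) hc hR hd
  exact exists_tendsto_flux (fun j => (hX j).of_le (by simp)) hR'

/-- The embedding of the plane as a continuous linear map. -/
noncomputable def inPlaneL : E2 →L[ℝ] E3 :=
  LinearMap.toContinuousLinearMap
    { toFun := inPlane
      map_add' := fun z w => by
        ext i
        fin_cases i <;> simp [inPlane]
      map_smul' := fun c z => by
        ext i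
        fin_cases i <;> simp [inPlane] }

theorem inPlaneL_apply (z : E2) : inPlaneL z = inPlane z := rfl

theorem inPlaneL_single (α : Fin 2) :
    inPlaneL (EuclideanSpace.single α 1) = EuclideanSpace.single α.castSucc 1 := by
  ext i
  rw [inPlaneL_apply]
  fin_cases α <;> fin_cases i <;> simp [inPlane]

theorem mapsTo_inPlane : Set.MapsTo inPlane (outer (n := 1) Set.univ) halfExterior := by
  intro z hz
  refine ⟨(inPlane_apply_two z).ge, ?_⟩
  rw [norm_inPlane]
  exact hz.2

theorem tendsto_inPlane : Tendsto inPlane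
    (Bornology.cobounded E2 ⊓ 𝓟 (outer (n := 1) Set.univ)) (atInfinity halfExterior) := by
  refine tendsto_inf.2 ⟨?_, ?_⟩
  · rw [← comap_norm_atTop (E := E3), tendsto_comap_iff]
    have : (fun x : E3 => ‖x‖) ∘ inPlane = fun z => ‖z‖ := funext norm_inPlane
    rw [this]
    exact tendsto_norm_cobounded_atTop.mono_left inf_le_left
  · exact tendsto_principal.2 (mem_inf_of_right mapsTo_inPlane)

/-- The tangential vector field on the boundary plane whose flux is the circle term. -/
def planeField (G : E3 → Matrix (Fin 3) (Fin 3) ℝ) (α : Fin 2) (z : E2) : ℝ :=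
  G (inPlane z) 2 α.castSucc

/-- The conormal has no third component, so only the entries `g_3α` of the metric enter. -/
theorem circleTerm_eq_flux (G : E3 → Matrix (Fin 3) (Fin 3) ℝ) {ρ : ℝ} (hρ : 1 < ρ) :
    circleTerm G ρ = flux (n := 1) (outer (n := 1) Set.univ) (planeField G) ρ := by
  rw [flux, (isRegularCone_univ (n := 1)).setOf_smul_mem_outer hρ, circleTerm, pow_one]
  simp only [Set.mem_univ, Set.ofPred_true, setIntegral_univ]
  congr 2
  ext v
  rw [Fin.sum_univ_castSucc]
  have h2 : inPlane (v : E2) (Fin.last 2) = 0 := inPlane_apply_two _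
  rw [h2, mul_zero, add_zero]
  exact Finset.sum_congr rfl fun α _ => by rw [inPlane_apply_castSucc]; rfl

/-! ### Half-space masses -/

section Half

variable {G : E3 → Matrix (Fin 3) (Fin 3) ℝ} {q : ℝ}

theorem IsSmoothMetric.contDiffOn_planeField (hG : IsSmoothMetric halfExterior G) (α : Fin 2) :
    ContDiffOn ℝ ∞ (planeField G α) (outer (n := 1) Set.univ) :=
  (hG.contDiffOn 2 α.castSucc).comp inPlaneL.contDiff.contDiffOn mapsTo_inPlane

/-- The directions `∂_α` are tangent to the plane, so derivatives within the plane agree with those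
within the half-space. -/
theorem IsSmoothMetric.divergence_planeField (hG : IsSmoothMetric halfExterior G) {z : E2}
    (hz : z ∈ outer (n := 1) Set.univ) :
    divergence (n := 1) (outer (n := 1) Set.univ) (planeField G) z
      = ∑ α : Fin 2, pd halfExterior α.castSucc (fun y => G y 2 α.castSucc) (inPlane z) := by
  refine Finset.sum_congr rfl fun α _ => ?_
  have hd := ((hG.contDiffOn 2 α.castSucc _ (mapsTo_inPlane hz)).differentiableWithinAt
    (by simp)).hasFDerivWithinAt
  have := (hd.comp z inPlaneL.hasFDerivWithinAt mapsTo_inPlane).fderivWithin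
    ((isRegularCone_univ (n := 1)).uniqueDiffOn_outer z hz)
  change fderivWithin ℝ ((fun y => G y 2 α.castSucc) ∘ inPlane) _ z _ = _
  rw [this, ContinuousLinearMap.comp_apply, inPlaneL_single]
  rfl

/-- The combined flux of an asymptotically flat half-space metric with integrable scalar curvature
and integrable mean curvature converges. -/
theorem exists_tendsto_massFlux_add_circleTerm
    (hG : IsSmoothMetric halfExterior G) (hq : DecaysAtRate halfExterior q G)
    (hR : IntegrableForVolume halfExterior G (scalarCurvature halfExterior G))
    (hH : IntegrableForArea G (meanCurvature halfExterior G)) :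
    ∃ L, Tendsto (fun ρ => massFlux halfExterior G ρ + circleTerm G ρ) atTop (𝓝 L) := by
  have hC := isRegularCone_halfSpace
  have hC' := isRegularCone_univ (n := 1)
  have hX := hG.contDiffOn_massForm
  have hY := hG.contDiffOn_planeField
  have hd := hq.scalarCurvature_density_sub hG
  have hm := hC.measurableSet_outer
  have hu := hC.uniqueDiffOn_outer
  rw [outer_halfSpace_eq] at hm hu
  have hc : ContinuousOn (divergence (n := 2) halfExterior (massForm halfExterior G))
      halfExterior := by
    refine continuousOn_finsetSum _ fun j _ => ?_
    exact ((hX j).continuousOn_fderivWithin hu (by simp)).clm_apply continuousOn_const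
  obtain ⟨R₁, hR₁⟩ := exists_integrableOn_of_isBigO_sub (n := 2) hm (p := -2 * q - 2)
    (by push_cast; linarith [hq.half_lt]) hc hR hd
  have hc' : ContinuousOn (fun z : E2 => massForm halfExterior G 2 (inPlane z)
      + divergence (n := 1) (outer (n := 1) Set.univ) (planeField G) z)
      (outer (n := 1) Set.univ) := by
    refine ((hX 2).continuousOn.comp continuous_inPlane.continuousOn mapsTo_inPlane).add ?_
    refine continuousOn_finsetSum _ fun j _ => ?_
    exact ((hY j).continuousOn_fderivWithin hC'.uniqueDiffOn_outer (by simp)).clm_apply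
      continuousOn_const
  have hH' : IntegrableOn (fun z => 2 * (meanCurvature halfExterior G z *
      √(inducedMetric G z).det)) (outer (n := 1) Set.univ) := by
    have : outer (n := 1) Set.univ = {z : E2 | 1 < ‖z‖} := by ext z; simp [outer]
    rw [this]
    exact Integrable.const_mul hH 2
  have hd' : (fun z : E2 => (massForm halfExterior G 2 (inPlane z)
      + divergence (n := 1) (outer (n := 1) Set.univ) (planeField G) z)
      - 2 * (meanCurvature halfExterior G z * √(inducedMetric G z).det))
      =O[Bornology.cobounded E2 ⊓ 𝓟 (outer (n := 1) Set.univ)] fun z => ‖z‖ ^ (-2 * q - 1) := by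
    refine (IsBigO.comp_tendsto (hq.boundary_sub hG) tendsto_inPlane).congr' ?_ ?_
    · filter_upwards [mem_inf_of_right (mem_principal_self _)] with z hz
      simp only [Function.comp_apply]
      rw [hG.divergence_planeField hz, meanCurvature_mul_eq]
    · exact Eventually.of_forall fun z => by simp only [Function.comp_apply, norm_inPlane]
  -- In the plane the threshold is `-2`, and again `-2q - 1 < -2`.
  obtain ⟨R₂, hR₂⟩ := exists_integrableOn_of_isBigO_sub (n := 1) hC'.measurableSet_outer
    (p := -2 * q - 1) (by push_cast; linarith [hq.half_lt]) hc' hH' hd'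
  have hX' : ∀ j, ContDiffOn ℝ 1 (massForm halfExterior G j) (outer (n := 2) halfSpace) := by
    rw [outer_halfSpace_eq]
    exact fun j => (hX j).of_le (by simp)
  have hY' : ∀ j, ContDiffOn ℝ 1 (planeField G j) (outer (n := 1) Set.univ) :=
    fun j => (hY j).of_le (by simp)
  obtain ⟨L, hL⟩ := exists_tendsto_flux_halfSpace (R := max R₁ R₂) hX' hY'
    (by
      rw [outer_halfSpace_eq]
      exact integrableOn_tail_mono (le_max_left _ _) hR₁)
    (integrableOn_tail_mono (le_max_right _ _) hR₂)
  refine ⟨L, hL.congr' ?_⟩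
  filter_upwards [eventually_gt_atTop 1] with ρ hρ
  rw [circleTerm_eq_flux G hρ, massFlux_eq_flux, outer_halfSpace_eq]

end Half

/-! ### Comparison of fluxes -/

section FluxComparison

variable {n : ℕ} {C : Set (EuclideanSpace ℝ (Fin (n + 1)))}
  {X Y : Fin (n + 1) → EuclideanSpace ℝ (Fin (n + 1)) → ℝ}

theorem IsRegularCone.integrableOn_sphere (hC : IsRegularCone C)
    (hX : ∀ j, ContinuousOn (X j) (outer C)) {ρ : ℝ} (hρ : 1 < ρ) :
    IntegrableOn (fun v : Metric.sphere (0 : EuclideanSpace ℝ (Fin (n + 1))) 1 =>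
      ∑ j, X j (ρ • (v : EuclideanSpace ℝ (Fin (n + 1)))) *
        (v : EuclideanSpace ℝ (Fin (n + 1))) j)
      {v : Metric.sphere (0 : EuclideanSpace ℝ (Fin (n + 1))) 1 |
        (v : EuclideanSpace ℝ (Fin (n + 1))) ∈ C}
      (volume : Measure (EuclideanSpace ℝ (Fin (n + 1)))).toSphere := by
  refine ContinuousOn.integrableOn_compact hC.isCompact_sphere_inter ?_
  refine continuousOn_finsetSum _ fun j _ => ContinuousOn.mul ?_ (by fun_prop)
  exact (hX j).comp (by fun_prop) fun v hv => hC.smul_mem_outer hρ hv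

theorem IsRegularCone.flux_sub (hC : IsRegularCone C) (hX : ∀ j, ContinuousOn (X j) (outer C))
    (hY : ∀ j, ContinuousOn (Y j) (outer C)) {ρ : ℝ} (hρ : 1 < ρ) :
    flux (outer C) (fun j x => X j x - Y j x) ρ
      = flux (outer C) X ρ - flux (outer C) Y ρ := by
  simp only [flux, hC.setOf_smul_mem_outer hρ]
  rw [← mul_sub, ← integral_sub (hC.integrableOn_sphere hX hρ) (hC.integrableOn_sphere hY hρ)]
  simp only [sub_mul, Finset.sum_sub_distrib]

theorem flux_const_mul (U : Set (EuclideanSpace ℝ (Fin (n + 1)))) (c ρ : ℝ) :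
    flux U (fun j x => c * X j x) ρ = c * flux U X ρ := by
  simp only [flux, mul_assoc, ← Finset.mul_sum]
  rw [integral_const_mul]
  ring

/-- The sphere of radius `ρ` has area of order `ρ ^ n`, so the flux is `O(ρ ^ (p + n))`. -/
theorem IsRegularCone.tendsto_flux_zero (hC : IsRegularCone C) {p : ℝ} (hp : p < -n)
    (hX : ∀ j, X j =O[Bornology.cobounded (EuclideanSpace ℝ (Fin (n + 1))) ⊓ 𝓟 (outer C)]
      fun x => ‖x‖ ^ p) : Tendsto (flux (outer C) X) atTop (𝓝 0) := by
  have hsum : (fun x => ∑ j, ‖X j x‖)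
      =O[Bornology.cobounded (EuclideanSpace ℝ (Fin (n + 1))) ⊓ 𝓟 (outer C)]
        fun x => ‖x‖ ^ p := IsBigO.fun_sum fun j _ => (hX j).norm_left
  obtain ⟨c, hc⟩ := hsum.bound
  rw [eventually_inf_principal, ← comap_norm_atTop, eventually_comap] at hc
  obtain ⟨R, hR⟩ := eventually_atTop.1 hc
  set K := {v : Metric.sphere (0 : EuclideanSpace ℝ (Fin (n + 1))) 1 |
    (v : EuclideanSpace ℝ (Fin (n + 1))) ∈ C}
  set μ := (volume : Measure (EuclideanSpace ℝ (Fin (n + 1)))).toSphere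
  have hbound : ∀ᶠ ρ : ℝ in atTop, ‖flux (outer C) X ρ‖ ≤ (c * μ.real K) * ρ ^ (p + n) := by
    filter_upwards [eventually_gt_atTop 1, eventually_ge_atTop R] with ρ hρ hρR
    have h0 : 0 < ρ := by linarith
    rw [flux, hC.setOf_smul_mem_outer hρ, norm_mul, Real.norm_of_nonneg (by positivity)]
    have hle : ‖∫ v in K, (∑ j, X j (ρ • (v : EuclideanSpace ℝ (Fin (n + 1)))) *
        (v : EuclideanSpace ℝ (Fin (n + 1))) j) ∂μ‖ ≤ (c * ρ ^ p) * μ.real K := by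
      refine norm_setIntegral_le_of_norm_le_const (measure_lt_top _ _) fun v hv => ?_
      have hnorm : ‖ρ • (v : EuclideanSpace ℝ (Fin (n + 1)))‖ = ρ := by
        simp [norm_smul, abs_of_pos h0]
      have h1 := hR ρ hρR _ hnorm (hC.smul_mem_outer hρ hv)
      rw [hnorm, Real.norm_of_nonneg (by positivity : 0 ≤ ρ ^ p),
        Real.norm_of_nonneg (by positivity)] at h1
      refine ((norm_sum_le _ _).trans (Finset.sum_le_sum fun j _ => ?_)).trans h1
      rw [norm_mul]
      refine mul_le_of_le_one_right (norm_nonneg _) ?_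
      have := PiLp.norm_apply_le (v : EuclideanSpace ℝ (Fin (n + 1))) j
      rwa [norm_eq_of_mem_sphere v] at this
    refine (mul_le_mul_of_nonneg_left hle (by positivity)).trans (le_of_eq ?_)
    rw [Real.rpow_add h0, Real.rpow_natCast]
    ring
  refine squeeze_zero_norm' hbound ?_
  have := (tendsto_rpow_neg_atTop (y := -(p + n)) (by linarith)).const_mul (c * μ.real K)
  simpa using this

theorem IsRegularCone.tendsto_flux_sub (hC : IsRegularCone C) {p : ℝ} (hp : p < -n)
    (hX : ∀ j, ContinuousOn (X j) (outer C)) (hY : ∀ j, ContinuousOn (Y j) (outer C))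
    (hXY : ∀ j, (fun x => X j x - Y j x)
      =O[Bornology.cobounded (EuclideanSpace ℝ (Fin (n + 1))) ⊓ 𝓟 (outer C)]
      fun x => ‖x‖ ^ p) :
    Tendsto (fun ρ => flux (outer C) X ρ - flux (outer C) Y ρ) atTop (𝓝 0) := by
  refine (hC.tendsto_flux_zero hp hXY).congr' ?_
  filter_upwards [eventually_gt_atTop 1] with ρ hρ
  exact hC.flux_sub hX hY hρ

end FluxComparison

/-! ### Conformal changes -/

section Conformal

variable {U : Set E3} {G : E3 → Matrix (Fin 3) (Fin 3) ℝ} {F : E3 → ℝ} {q : ℝ}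

/-- A positive smooth function on `U` that tends to `1` at rate `q`, with its derivatives. -/
structure DecayingFactor (U : Set E3) (q : ℝ) (F : E3 → ℝ) : Prop where
  contDiffOn : ContDiffOn ℝ ∞ F U
  pos : ∀ x ∈ U, 0 < F x
  sub_one : DecayO U (-q) fun x => F x - 1
  decayO_pd : ∀ k, DecayO U (-q - 1) (pd U k F)

theorem DecayingFactor.mono {q' : ℝ} (hF : DecayingFactor U q F) (h : q' ≤ q) :
    DecayingFactor U q' F where
  contDiffOn := hF.contDiffOn
  pos := hF.pos
  sub_one := hF.sub_one.mono (by linarith)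
  decayO_pd k := (hF.decayO_pd k).mono (by linarith)

theorem DecayingFactor.rpow (hF : DecayingFactor U q F) (hU : UniqueDiffOn ℝ U) (hq : 0 < q)
    (s : ℝ) : DecayingFactor U q fun x => F x ^ s where
  contDiffOn x hx := (hF.contDiffOn x hx).rpow_const_of_ne (hF.pos x hx).ne'
  pos x hx := Real.rpow_pos_of_pos (hF.pos x hx) s
  sub_one := by
    -- The composition lemmas take families of functions; here the family has one member.
    have := decayO_comp_sub (h := fun x (_ : Unit) => F x) (c := fun _ => 1)
      (Θ := fun w => w () ^ s) ?_ hq fun _ => hF.sub_one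
    · simpa using this
    · exact ContDiffAt.rpow_const_of_ne (by fun_prop) one_ne_zero
  decayO_pd k :=
    decayO_pd_comp (h := fun x (_ : Unit) => F x) (c := fun _ => 1)
      (Θ := fun w => w () ^ s) hU
      (ContDiffAt.rpow_const_of_ne (by fun_prop) one_ne_zero) hq (fun _ => hF.sub_one) k
      (fun _ => hF.decayO_pd k)
      fun _ x hx => (hF.contDiffOn x hx).differentiableWithinAt (by simp)

theorem IsSmoothMetric.smul {P : E3 → ℝ} (hG : IsSmoothMetric U G) (hP : ContDiffOn ℝ ∞ P U)
    (hpos : ∀ x ∈ U, 0 < P x) : IsSmoothMetric U fun x => P x • G x where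
  uniqueDiffOn := hG.uniqueDiffOn
  contDiffOn i j := by
    simp only [Matrix.smul_apply, smul_eq_mul]
    exact hP.mul (hG.contDiffOn i j)
  det_pos x hx := by
    rw [Matrix.det_smul]
    have := hpos x hx
    have := hG.det_pos x hx
    positivity
  diag_pos x hx i := mul_pos (hpos x hx) (hG.diag_pos x hx i)
  symm x hx i j := by
    simp only [Matrix.smul_apply, hG.symm x hx i j]

theorem pd_rpow {k : Fin 3} {x : E3} (hu : UniqueDiffWithinAt ℝ U x)
    (hF : DifferentiableWithinAt ℝ F U x) (hpos : F x ≠ 0) (s : ℝ) :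
    pd U k (fun y => F y ^ s) x = s * F x ^ (s - 1) * pd U k F x := by
  have := (hF.hasFDerivWithinAt.rpow_const (p := s) (Or.inl hpos)).fderivWithin hu
  rw [pd, this, pd]
  simp

/-- To leading order, the conformal change by `F ^ s` changes the mass form by `-2 s dF`. -/
theorem DecayingFactor.massForm_sub (hF : DecayingFactor U q F) (hG : IsSmoothMetric U G)
    (hq : DecaysAtRate U q G) (s : ℝ) (j : Fin 3) :
    DecayO U (-2 * q - 1) fun x => massForm U (fun x => F x ^ s • G x) j x
      - (massForm U G j x - 2 * s * pd U j F x) := by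
  have hq0 : 0 < q := by linarith [hq.half_lt]
  have hs := hF.rpow hG.uniqueDiffOn hq0 s
  have hs' := hF.rpow hG.uniqueDiffOn hq0 (s - 1)
  -- Leibniz: `∂(F^s g_ab) = F^s ∂g_ab + s F^(s-1) ∂F g_ab`, where replacing `F^s` by `1` and
  -- `F^(s-1) g_ab` by `δ_ab` is a quadratic error.
  have key : ∀ k a b, DecayO U (-2 * q - 1) fun x =>
      pd U k (fun y => (F y ^ s • G y) a b) x
        - (pd U k (fun y => G y a b) x + s * pd U k F x * (1 : Matrix (Fin 3) (Fin 3) ℝ) a b) := by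
    intro k a b
    have hFG : DecayO U (-q) fun x =>
        F x ^ (s - 1) * G x a b - (1 : Matrix (Fin 3) (Fin 3) ℝ) a b := by
      have h1 := hs'.sub_one.mul (DecayO.of_sub_const hq0.le (hq.sub_one a b))
      refine ((h1.mono (q := -q) (by linarith)).add (hq.sub_one a b)).congr fun x _ => by ring
    have h1 := (hs.sub_one.mul (hq.decayO_pd k a b)).mono (q := -2 * q - 1) (by linarith)
    have h2 := (((hF.decayO_pd k).mul hFG).const_mul s).mono (q := -2 * q - 1) (by linarith)
    refine (h1.add h2).congr fun x hx => ?_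
    have hu := hG.uniqueDiffOn x hx
    have hdF := (hF.contDiffOn x hx).differentiableWithinAt (by simp : (∞ : WithTop ℕ∞) ≠ 0)
    have hds := (hs.contDiffOn x hx).differentiableWithinAt (by simp : (∞ : WithTop ℕ∞) ≠ 0)
    have hdG := (hG.contDiffOn a b x hx).differentiableWithinAt (by simp : (∞ : WithTop ℕ∞) ≠ 0)
    have h3 : pd U k (fun y => (F y ^ s • G y) a b) x
        = s * F x ^ (s - 1) * pd U k F x * G x a b + F x ^ s * pd U k (fun y => G y a b) x := by
      simp only [Matrix.smul_apply, smul_eq_mul]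
      rw [pd_mul k hu hds hdG, pd_rpow hu hdF (hF.pos x hx).ne']
    rw [h3]
    ring
  have h1 : DecayO U (-2 * q - 1) fun x => ∑ i,
      ((pd U i (fun y => (F y ^ s • G y) i j) x
        - (pd U i (fun y => G y i j) x + s * pd U i F x * (1 : Matrix (Fin 3) (Fin 3) ℝ) i j))
      - (pd U j (fun y => (F y ^ s • G y) i i) x
        - (pd U j (fun y => G y i i) x + s * pd U j F x * (1 : Matrix (Fin 3) (Fin 3) ℝ) i i))) :=
    DecayO.sum fun i _ => (key i i j).sub (key j i i)
  refine h1.congr fun x _ => ?_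
  -- The divergence part contributes one copy of `s ∂_j F`, the trace part three, leaving `-2 s ∂_j
  -- F`.
  have h2 : ∑ i, pd U i F x * (1 : Matrix (Fin 3) (Fin 3) ℝ) i j = pd U j F x := by
    simp [Matrix.one_apply]
  simp only [massForm, Finset.sum_sub_distrib, Finset.sum_add_distrib, mul_assoc, ← Finset.mul_sum,
    h2, Matrix.one_apply_eq, mul_one, Finset.sum_const, Finset.card_univ, Fintype.card_fin]
  simp
  ring

theorem DecayingFactor.tendsto_massFlux_sub {C : Set E3} (hC : IsRegularCone (n := 2) C)
    (hU : outer (n := 2) C = U) (hF : DecayingFactor U q F)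
    (hG : IsSmoothMetric U G) (hq : DecaysAtRate U q G) (s : ℝ) :
    Tendsto (fun ρ => massFlux U (fun x => F x ^ s • G x) ρ
      - (massFlux U G ρ - 2 * s * flux (n := 2) U (fun j => pd U j F) ρ)) atTop (𝓝 0) := by
  have hq0 : 0 < q := by linarith [hq.half_lt]
  have hs := hF.rpow hG.uniqueDiffOn hq0 s
  have hGs := hG.smul hs.contDiffOn hs.pos
  have hc1 := fun j => (hGs.contDiffOn_massForm j).continuousOn
  have hc2 := fun j => (hG.contDiffOn_massForm j).continuousOn
  have hc3 : ∀ j, ContinuousOn (fun x => 2 * s * pd U j F x) U := fun j =>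
    continuousOn_const.mul (contDiffOn_pd j hG.uniqueDiffOn hF.contDiffOn).continuousOn
  have hd := hF.massForm_sub hG hq s
  subst hU
  have := hC.tendsto_flux_sub (p := -2 * q - 1) (by push_cast; linarith [hq.half_lt]) hc1
    (fun j => (hc2 j).sub (hc3 j)) hd
  refine this.congr' ?_
  filter_upwards [eventually_gt_atTop 1] with ρ hρ
  rw [massFlux_eq_flux, massFlux_eq_flux, ← flux_const_mul, ← hC.flux_sub hc2 hc3 hρ]
  rfl

/-- The entries `g_3α` tend to `0`, so the change `(F ^ s - 1) g_3α` is `O(r^(-2q))`, which beats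
the length of the circle. -/
theorem DecayingFactor.tendsto_circleTerm_sub (hF : DecayingFactor halfExterior q F)
    (hG : IsSmoothMetric halfExterior G) (hq : DecaysAtRate halfExterior q G) (s : ℝ) :
    Tendsto (fun ρ => circleTerm (fun x => F x ^ s • G x) ρ - circleTerm G ρ) atTop (𝓝 0) := by
  have hq0 : 0 < q := by linarith [hq.half_lt]
  have hs := hF.rpow hG.uniqueDiffOn hq0 s
  have hGs := hG.smul hs.contDiffOn hs.pos
  have hd : ∀ α, (fun z => planeField (fun x => F x ^ s • G x) α z - planeField G α z)
      =O[Bornology.cobounded E2 ⊓ 𝓟 (outer (n := 1) Set.univ)] fun z => ‖z‖ ^ (-2 * q) := by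
    intro α
    have h1 : DecayO halfExterior (-2 * q) fun x =>
        (F x ^ s • G x) 2 α.castSucc - G x 2 α.castSucc := by
      refine ((hs.sub_one.mul (hq.sub_one 2 α.castSucc)).mono
        (q := -2 * q) (by linarith)).congr fun x _ => ?_
      have h2 : (2 : Fin 3) ≠ α.castSucc := (Fin.castSucc_lt_last α).ne'
      rw [Matrix.one_apply_ne h2, Matrix.smul_apply, smul_eq_mul]
      ring
    refine (IsBigO.comp_tendsto h1 tendsto_inPlane).congr (fun z => rfl) fun z => ?_
    simp only [Function.comp_apply, norm_inPlane]
  have := (isRegularCone_univ (n := 1)).tendsto_flux_sub (p := -2 * q)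
    (by push_cast; linarith [hq.half_lt]) (fun α => (hGs.contDiffOn_planeField α).continuousOn)
    (fun α => (hG.contDiffOn_planeField α).continuousOn) hd
  refine this.congr' ?_
  filter_upwards [eventually_gt_atTop 1] with ρ hρ
  rw [circleTerm_eq_flux _ hρ, circleTerm_eq_flux _ hρ]

/-- If `Ψs s` is asymptotic to `Ψ - 2 s N` for all `s`, and `Ψ` and `Ψs 4` converge, then so do all
`Ψs s`, with limits that are affine in `s`. -/
theorem tendsto_of_tendsto_sub_affine {Ψ N : ℝ → ℝ} {Ψs : ℝ → ℝ → ℝ} {A B : ℝ}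
    (hsub : ∀ s, Tendsto (fun ρ => Ψs s ρ - (Ψ ρ - 2 * s * N ρ)) atTop (𝓝 0))
    (hA : Tendsto Ψ atTop (𝓝 A)) (hB : Tendsto (Ψs 4) atTop (𝓝 B)) (t : ℝ) :
    Tendsto (Ψs (4 * t)) atTop (𝓝 ((1 - t) * A + t * B)) := by
  have h4 := (((hsub 4).sub hB).add hA).const_mul (1 / 8)
  -- The case `s = 4` is solved for `N`, giving the limit `(A - B) / 8`.
  have hN : Tendsto N atTop (𝓝 (1 / 8 * (0 - B + A))) := by
    refine h4.congr fun ρ => ?_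
    ring
  have := ((hsub (4 * t)).add hA).sub (hN.const_mul (2 * (4 * t)))
  have he : (1 - t) * A + t * B = 0 + A - 2 * (4 * t) * (1 / 8 * (0 - B + A)) := by ring
  rw [he]
  refine this.congr fun ρ => ?_
  ring

end Conformal

/-! ### Masses of conformal metrics in coordinates -/

section Gradient

variable {U : Set E3} {G : E3 → Matrix (Fin 3) (Fin 3) ℝ} {F : E3 → ℝ} {q : ℝ}

/-- With entrywise error `1/6`, the loss is at most `1/12 ∑_{i,j} (v_i² + v_j²) = 1/2 ∑ v_i²`. -/
theorem half_sum_sq_le {A : Matrix (Fin 3) (Fin 3) ℝ}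
    (hA : ∀ i j, |A i j - (1 : Matrix (Fin 3) (Fin 3) ℝ) i j| ≤ 1 / 6) (v : Fin 3 → ℝ) :
    1 / 2 * ∑ i, v i ^ 2 ≤ ∑ i, ∑ j, A i j * v i * v j := by
  have h1 : ∀ i j, (1 : Matrix (Fin 3) (Fin 3) ℝ) i j * (v i * v j) - 1 / 12 * (v i ^ 2 + v j ^ 2)
      ≤ A i j * v i * v j := by
    intro i j
    have h2 : -((A i j - (1 : Matrix (Fin 3) (Fin 3) ℝ) i j) * (v i * v j))
        ≤ 1 / 6 * ((v i ^ 2 + v j ^ 2) / 2) := by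
      refine (neg_le_abs _).trans ?_
      rw [abs_mul]
      refine mul_le_mul (hA i j) ?_ (abs_nonneg _) (by norm_num)
      rw [abs_le]
      constructor <;> nlinarith [sq_nonneg (v i + v j), sq_nonneg (v i - v j)]
    linarith
  refine le_trans (le_of_eq ?_) (Finset.sum_le_sum fun i _ => Finset.sum_le_sum fun j _ => h1 i j)
  simp [Fin.sum_univ_three, Matrix.one_apply]
  ring

/-- Far out the inverse metric dominates half the Euclidean one, so the Riemannian gradient norm
controls each coordinate derivative. -/
theorem DecaysAtRate.decayO_pd_of_gradientNorm (hq : DecaysAtRate U q G) {q' : ℝ}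
    (h : DecayO U (-q') fun x => ‖x‖ * gradientNorm U G F x) (k : Fin 3) :
    DecayO U (-q' - 1) (pd U k F) := by
  have h1 : DecayO U (-q' - 1) fun x => gradientNorm U G F x := by
    have h2 : DecayO U (-1) fun x => ‖x‖ ^ (-1 : ℝ) := isBigO_refl _ _
    refine ((h2.mul h).mono (q := -q' - 1) (by linarith)).congr_eventually ?_
    filter_upwards [eventually_le_norm_atInfinity 1] with x hx
    rw [Real.rpow_neg_one]
    field_simp
  refine IsBigO.trans (IsBigO.of_bound 2 ?_) h1
  have hclose : ∀ᶠ x in atInfinity U, ∀ i j,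
      |(G x)⁻¹ i j - (1 : Matrix (Fin 3) (Fin 3) ℝ) i j| ≤ 1 / 6 := by
    rw [eventually_all]
    intro i
    rw [eventually_all]
    intro j
    have := ((hq.inv_sub_one i j).tendsto_zero (by linarith [hq.half_lt])).abs
    rw [abs_zero] at this
    exact this.eventually_le_const (by norm_num)
  filter_upwards [hclose] with x hx
  have h3 := half_sum_sq_le hx fun i => pd U i F x
  have h4 : pd U k F x ^ 2 ≤ ∑ i, pd U i F x ^ 2 :=
    Finset.single_le_sum (f := fun i => pd U i F x ^ 2) (fun i _ => sq_nonneg _)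
      (Finset.mem_univ k)
  rw [Real.norm_eq_abs, gradientNorm, Real.norm_of_nonneg (Real.sqrt_nonneg _)]
  refine abs_le_of_sq_le_sq ?_ (by positivity)
  rw [mul_pow, Real.sq_sqrt (by linarith [sq_nonneg (pd U k F x)])]
  linarith [sq_nonneg (pd U k F x)]

/-- The vector field `√g ∇f`, whose divergence is the density of the Laplacian. -/
noncomputable def gradientField (U : Set E3) (G : E3 → Matrix (Fin 3) (Fin 3) ℝ) (F : E3 → ℝ)
    (i : Fin 3) (y : E3) : ℝ :=
  ∑ j, volumeDensity G y * (G y)⁻¹ i j * pd U j F y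

theorem IsSmoothMetric.contDiffOn_gradientField (hG : IsSmoothMetric U G)
    (hF : ContDiffOn ℝ ∞ F U) (i : Fin 3) : ContDiffOn ℝ ∞ (gradientField U G F i) U :=
  ContDiffOn.sum fun j _ => (hG.contDiffOn_volumeDensity.mul (hG.contDiffOn_inv i j)).mul
    (ConformalMass.contDiffOn_pd j hG.uniqueDiffOn hF)

theorem IsSmoothMetric.divergence_gradientField (hG : IsSmoothMetric U G) {x : E3}
    (hx : x ∈ U) :
    divergence (n := 2) U (gradientField U G F) x = laplacian U G F x * volumeDensity G x := by
  have h0 : volumeDensity G x ≠ 0 := (Real.sqrt_pos.2 (hG.det_pos x hx)).ne'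
  rw [laplacian, mul_comm, ← mul_assoc, mul_inv_cancel₀ h0, one_mul]
  rfl

/-- Lets the flux of `dF`, which enters the mass, be replaced by that of `√g ∇F`, whose divergence
is controlled. -/
theorem DecayingFactor.gradientField_sub (hF : DecayingFactor U q F) (hq : DecaysAtRate U q G)
    (i : Fin 3) :
    DecayO U (-2 * q - 1) fun x => gradientField U G F i x - pd U i F x := by
  have hq0 : 0 < q := by linarith [hq.half_lt]
  have h1 : ∀ j, DecayO U (-q) fun x =>
      volumeDensity G x * (G x)⁻¹ i j - (1 : Matrix (Fin 3) (Fin 3) ℝ) i j := by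
    intro j
    refine (((hq.volumeDensity_sub_one.mul
      (DecayO.of_sub_const hq0.le (hq.inv_sub_one i j))).mono (q := -q) (by linarith)).add
      (hq.inv_sub_one i j)).congr fun x _ => by ring
  have h2 : DecayO U (-2 * q - 1) fun x => ∑ j,
      (volumeDensity G x * (G x)⁻¹ i j - (1 : Matrix (Fin 3) (Fin 3) ℝ) i j) * pd U j F x :=
    DecayO.sum fun j _ => ((h1 j).mul (hF.decayO_pd j)).mono (by linarith)
  refine h2.congr fun x _ => ?_
  simp only [sub_mul, Finset.sum_sub_distrib, sum_one_mul, gradientField]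

end Gradient

section Masses

variable {G : E3 → Matrix (Fin 3) (Fin 3) ℝ} {F : E3 → ℝ} {q : ℝ}

/-- The flux of the gradient of a function with integrable Laplacian converges. -/
theorem DecayingFactor.exists_tendsto_flux_pd (hF : DecayingFactor exterior q F)
    (hG : IsSmoothMetric exterior G) (hq : DecaysAtRate exterior q G)
    (hΔ : IntegrableForVolume exterior G (laplacian exterior G F)) :
    ∃ N, Tendsto (flux (n := 2) exterior fun j => pd exterior j F) atTop (𝓝 N) := by
  have hC := isRegularCone_univ (n := 2)
  have hm := hC.measurableSet_outer
  have hV := hG.contDiffOn_gradientField hF.contDiffOn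
  have hV' := fun j => contDiffOn_pd j hG.uniqueDiffOn hF.contDiffOn
  have hdec := hF.gradientField_sub hq
  have hdiv : IntegrableOn (divergence (n := 2) exterior (gradientField exterior G F))
      exterior := by
    rw [outer_univ_eq_exterior] at hm
    exact IntegrableOn.congr_fun hΔ (fun x hx => (hG.divergence_gradientField hx).symm) hm
  rw [← outer_univ_eq_exterior] at *
  obtain ⟨N, hN⟩ := exists_tendsto_flux (R := 0) (fun j => (hV j).of_le (by simp))
    (hdiv.mono_set Set.inter_subset_left)
  have := hC.tendsto_flux_sub (p := -2 * q - 1) (by push_cast; linarith [hq.half_lt])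
    (fun j => (hV j).continuousOn) (fun j => (hV' j).continuousOn) hdec
  refine ⟨N, ?_⟩
  have h2 := hN.sub this
  rw [sub_zero] at h2
  refine h2.congr fun ρ => ?_
  ring

/-- The mass of `F ^ (4 t) g` interpolates linearly between the masses of `g` and `F ^ 4 g`. -/
theorem DecayingFactor.exists_tendsto_massFlux (hF : DecayingFactor exterior q F)
    (hG : IsSmoothMetric exterior G) (hq : DecaysAtRate exterior q G)
    (hR : IntegrableForVolume exterior G (scalarCurvature exterior G))
    (hΔ : IntegrableForVolume exterior G (laplacian exterior G F)) :
    ∃ A B, Tendsto (massFlux exterior G) atTop (𝓝 A) ∧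
      Tendsto (massFlux exterior fun x => F x ^ (4 : ℝ) • G x) atTop (𝓝 B) ∧
      ∀ t : ℝ, Tendsto (massFlux exterior fun x => F x ^ (4 * t) • G x) atTop
        (𝓝 ((1 - t) * A + t * B)) := by
  obtain ⟨A, hA⟩ := ConformalMass.exists_tendsto_massFlux hG hq hR
  obtain ⟨N, hN⟩ := hF.exists_tendsto_flux_pd hG hq hΔ
  have hsub := hF.tendsto_massFlux_sub (isRegularCone_univ (n := 2)) outer_univ_eq_exterior hG hq
  have hB := ((hsub 4).add hA).sub (hN.const_mul (2 * 4))
  -- The limit is `A - 8 N`: here the mass of `F⁴ g` is deduced from that of `g` and the flux of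
  -- `dF`.
  have hB' : Tendsto (massFlux exterior fun x => F x ^ (4 : ℝ) • G x) atTop
      (𝓝 (0 + A - 2 * 4 * N)) := hB.congr fun ρ => by ring
  exact ⟨A, _, hA, hB', tendsto_of_tendsto_sub_affine
    (Ψs := fun s => massFlux exterior fun x => F x ^ s • G x) hsub hA hB'⟩

/-- A conformal factor between two asymptotically flat metrics tends to `1`. -/
theorem DecaysAtRate.decayingFactor {U : Set E3} (hG : IsSmoothMetric U G)
    (hq : DecaysAtRate U q G) (hq' : DecaysAtRate U q fun x => F x ^ (4 : ℝ) • G x)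
    (hF : ContDiffOn ℝ ∞ F U) (hpos : ∀ x ∈ U, 0 < F x) : DecayingFactor U q F := by
  have hq0 : 0 < q := by linarith [hq.half_lt]
  -- `F` is recovered as the fourth root of the quotient of the first diagonal entries of the two
  -- metrics, a smooth function of them near `(1, 1)`.
  let h : E3 → Fin 2 → ℝ := fun x => ![F x ^ (4 : ℝ) * G x 0 0, G x 0 0]
  let Θ : (Fin 2 → ℝ) → ℝ := fun w => (w 0 / w 1) ^ (1 / 4 : ℝ)
  have hΘ : ContDiffAt ℝ 1 Θ (fun _ => 1) := by
    refine ContDiffAt.rpow_const_of_ne (ContDiffAt.div (by fun_prop) (by fun_prop) one_ne_zero) ?_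
    simp
  have h4 : ContDiffOn ℝ ∞ (fun x => F x ^ (4 : ℝ)) U := fun x hx =>
    (hF x hx).rpow_const_of_ne (hpos x hx).ne'
  have heq : ∀ x ∈ U, Θ (h x) = F x := by
    intro x hx
    have := (hG.diag_pos x hx 0).ne'
    have hp := hpos x hx
    simp only [Θ, h, Matrix.cons_val_zero, Matrix.cons_val_one]
    rw [mul_div_assoc, div_self this, mul_one, ← Real.rpow_mul hp.le]
    norm_num
  have h0 : ∀ i, DecayO U (-q) fun x => h x i - 1 := by
    intro i
    fin_cases i
    · simpa [h] using hq'.sub_one 0 0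
    · simpa [h] using hq.sub_one 0 0
  have h1 : ∀ k i, DecayO U (-q - 1) (pd U k fun x => h x i) := by
    intro k i
    fin_cases i
    · simpa [h] using hq'.decayO_pd k 0 0
    · simpa [h] using hq.decayO_pd k 0 0
  have hd : ∀ i, ∀ x ∈ U, DifferentiableWithinAt ℝ (fun x => h x i) U x := by
    intro i x hx
    fin_cases i
    · exact ((h4.mul (hG.contDiffOn 0 0)) x hx).differentiableWithinAt (by simp)
    · exact (hG.contDiffOn 0 0 x hx).differentiableWithinAt (by simp)
  refine ⟨hF, hpos, ?_, fun k => ?_⟩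
  · refine (decayO_comp_sub hΘ hq0 h0).congr fun x hx => ?_
    rw [heq x hx]
    simp [Θ]
  · exact (decayO_pd_comp hG.uniqueDiffOn hΘ hq0 h0 k (h1 k) hd).congr fun x hx =>
      pd_congr heq hx k

theorem DecayingFactor.tendsto_massFlux_add_circleTerm (hF : DecayingFactor halfExterior q F)
    (hG : IsSmoothMetric halfExterior G) (hq : DecaysAtRate halfExterior q G) {A B : ℝ}
    (hA : Tendsto (fun ρ => massFlux halfExterior G ρ + circleTerm G ρ) atTop (𝓝 A))
    (hB : Tendsto (fun ρ => massFlux halfExterior (fun x => F x ^ (4 : ℝ) • G x) ρ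
      + circleTerm (fun x => F x ^ (4 : ℝ) • G x) ρ) atTop (𝓝 B)) (t : ℝ) :
    Tendsto (fun ρ => massFlux halfExterior (fun x => F x ^ (4 * t) • G x) ρ
      + circleTerm (fun x => F x ^ (4 * t) • G x) ρ) atTop (𝓝 ((1 - t) * A + t * B)) := by
  refine tendsto_of_tendsto_sub_affine
    (Ψs := fun s ρ => massFlux halfExterior (fun x => F x ^ s • G x) ρ
      + circleTerm (fun x => F x ^ s • G x) ρ)
    (N := flux (n := 2) halfExterior fun j => pd halfExterior j F) (fun s => ?_) hA hB t
  have := (hF.tendsto_massFlux_sub isRegularCone_halfSpace outer_halfSpace_eq hG hq s).add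
    (hF.tendsto_circleTerm_sub hG hq s)
  rw [add_zero] at this
  refine this.congr fun ρ => ?_
  ring

end Masses

/-! ### The coordinate expression of a metric -/

/-- The Gram matrix is that of the inner product pulled back by an injective map, hence positive
definite. -/
theorem det_gram_pos {V : Type*} [AddCommGroup V] [Module ℝ V] (B : V → V → ℝ)
    (hadd : ∀ u v w, B (u + v) w = B u w + B v w) (hsmul : ∀ (c : ℝ) v w, B (c • v) w = c * B v w)
    (hsymm : ∀ v w, B v w = B w v) (hpos : ∀ v, v ≠ 0 → 0 < B v v) (D : E3 →ₗ[ℝ] V)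
    (hD : ∀ v, v ≠ 0 → D v ≠ 0) :
    0 < (Matrix.of fun i j : Fin 3 => B (D (EuclideanSpace.single i (1 : ℝ)))
      (D (EuclideanSpace.single j (1 : ℝ)))).det := by
  refine Matrix.PosDef.det_pos (Matrix.PosDef.of_dotProduct_mulVec_pos ?_ fun w hw => ?_)
  · ext i j
    exact hsymm _ _
  · have hw' : (WithLp.toLp 2 w : E3) ≠ 0 := fun h => hw (by simpa using h)
    have hsum : (WithLp.toLp 2 w : E3) = w 0 • EuclideanSpace.single 0 (1 : ℝ)
        + w 1 • EuclideanSpace.single 1 (1 : ℝ) + w 2 • EuclideanSpace.single 2 (1 : ℝ) := by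
      ext i
      fin_cases i <;> simp
    have hadd' : ∀ u v w, B u (v + w) = B u v + B u w := fun u v w => by
      rw [hsymm, hadd, hsymm v, hsymm w]
    have hsmul' : ∀ (c : ℝ) v w, B v (c • w) = c * B v w := fun c v w => by
      rw [hsymm, hsmul, hsymm]
    refine (hpos _ (hD _ hw')).trans_eq ?_
    rw [hsum]
    simp only [map_add, map_smul, hadd, hadd', hsmul, hsmul', dotProduct, Matrix.mulVec,
      Fin.sum_univ_three, Matrix.of_apply, star_trivial]
    ring

section Chart

variable {H : Type*} [TopologicalSpace H] {I : ModelWithCorners ℝ E3 H}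
  {M : Type*} [TopologicalSpace M] [ChartedSpace H M] {U : Set E3}

/-- These fields are images of constant fields under the tangent map of the inverse chart. -/
theorem EndChart.contMDiffOn_basis [IsManifold I ∞ M] (e : EndChart I M U)
    (hU : UniqueDiffOn ℝ U) (v : E3) :
    ContMDiffOn 𝓘(ℝ, E3) I.tangent ∞ (fun x => (⟨e.invFun x,
      mfderivWithin 𝓘(ℝ, E3) I e.invFun U x v⟩ : TangentBundle I M)) U := by
  have h1 := e.contMDiffOn_inv.contMDiffOn_tangentMapWithin (m := ∞) (by simp) hU.uniqueMDiffOn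
  have h2 : ContMDiffOn 𝓘(ℝ, E3) 𝓘(ℝ, E3).tangent ∞
      (fun x => (⟨x, v⟩ : TangentBundle 𝓘(ℝ, E3) E3)) U :=
    contMDiffOn_vectorSpace_iff_contDiffOn.2 contDiffOn_const
  exact h1.comp h2 fun x hx => hx

theorem EndChart.contDiffOn_coordMetric [IsManifold I ∞ M] (e : EndChart I M U)
    (hU : UniqueDiffOn ℝ U) (g : Metric3 I M) (i j : Fin 3) : ContDiffOn ℝ ∞ (fun x => coordMetric e g x i j) U := by
  rw [← contMDiffOn_iff_contDiffOn]
  have h1 : ContMDiffOn 𝓘(ℝ, E3) (I.prod 𝓘(ℝ, E3 →L[ℝ] E3 →L[ℝ] ℝ)) ∞ (fun x =>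
      TotalSpace.mk' (E3 →L[ℝ] E3 →L[ℝ] ℝ)
        (E := fun p : M => TangentSpace I p →L[ℝ] TangentSpace I p →L[ℝ] ℝ)
        (e.invFun x) (g.inner (e.invFun x))) U :=
    g.contMDiff.comp_contMDiffOn e.contMDiffOn_inv
  have h2 : ContMDiffOn 𝓘(ℝ, E3) (I.prod 𝓘(ℝ, ℝ)) ∞ (fun x =>
      TotalSpace.mk' ℝ (E := Bundle.Trivial M ℝ) (e.invFun x) (g.inner (e.invFun x)
        (mfderivWithin 𝓘(ℝ, E3) I e.invFun U x (EuclideanSpace.single i (1 : ℝ)))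
        (mfderivWithin 𝓘(ℝ, E3) I e.invFun U x (EuclideanSpace.single j (1 : ℝ))))) U :=
    ContMDiffOn.clm_bundle_apply₂ (F₁ := E3) (F₂ := E3) h1 (e.contMDiffOn_basis hU _)
      (e.contMDiffOn_basis hU _)
  intro x hx
  have h3 := h2 x hx
  simp only [contMDiffWithinAt_totalSpace] at h3
  exact h3.2

/-- Differentiating `toFun ∘ invFun = id` on `U` shows that the derivative is injective. -/
theorem EndChart.mfderivWithin_invFun_ne_zero (e : EndChart I M U) (hU : UniqueDiffOn ℝ U)
    {x : E3} (hx : x ∈ U) {v : E3} (hv : v ≠ 0) :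
    mfderivWithin 𝓘(ℝ, E3) I e.invFun U x v ≠ 0 := by
  intro h0
  have hu : UniqueMDiffWithinAt 𝓘(ℝ, E3) U x := hU.uniqueMDiffOn x hx
  have h1 := mfderivWithin_comp x
    ((e.contMDiffOn _ (e.mapsTo_inv hx)).mdifferentiableWithinAt (by simp))
    ((e.contMDiffOn_inv x hx).mdifferentiableWithinAt (by simp)) e.mapsTo_inv hu
  have h2 : mfderivWithin 𝓘(ℝ, E3) 𝓘(ℝ, E3) (e.toFun ∘ e.invFun) U x
      = mfderivWithin 𝓘(ℝ, E3) 𝓘(ℝ, E3) id U x :=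
    mfderivWithin_congr (fun y hy => e.right_inv hy) (e.right_inv hx)
  have h3 := mfderivWithin_id (I := 𝓘(ℝ, E3)) hu
  have h4 : mfderivWithin 𝓘(ℝ, E3) 𝓘(ℝ, E3) (e.toFun ∘ e.invFun) U x v = v := by
    rw [h2, h3]
    rfl
  rw [h1] at h4
  refine hv (h4.symm.trans ?_)
  change (mfderivWithin I 𝓘(ℝ, E3) e.toFun e.source (e.invFun x))
    ((mfderivWithin 𝓘(ℝ, E3) I e.invFun U x) v) = 0
  rw [h0, map_zero]

theorem EndChart.isSmoothMetric [IsManifold I ∞ M] (e : EndChart I M U) (hU : UniqueDiffOn ℝ U)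
    (g : Metric3 I M) : IsSmoothMetric U (coordMetric e g) where
  uniqueDiffOn := hU
  contDiffOn := e.contDiffOn_coordMetric hU g
  symm x _ i j := g.symm _ _ _
  diag_pos x hx i := g.pos _ _ (e.mfderivWithin_invFun_ne_zero hU hx (by simp))
  det_pos x hx := det_gram_pos (V := TangentSpace I (e.invFun x))
    (fun v w => g.inner (e.invFun x) v w) (fun u v w => by simp) (fun c v w => by simp)
    (g.symm _) (fun v hv => g.pos _ v hv)
    (mfderivWithin 𝓘(ℝ, E3) I e.invFun U x).toLinearMap
    fun v hv => e.mfderivWithin_invFun_ne_zero hU hx hv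

theorem EndChart.contDiffOn_comp (e : EndChart I M U) {f : M → ℝ}
    (hf : ContMDiff I 𝓘(ℝ, ℝ) ∞ f) : ContDiffOn ℝ ∞ (f ∘ e.invFun) U := by
  rw [← contMDiffOn_iff_contDiffOn]
  exact hf.comp_contMDiffOn e.contMDiffOn_inv

end Chart

theorem uniqueDiffOn_exterior : UniqueDiffOn ℝ exterior := by
  rw [← outer_univ_eq_exterior]
  exact (isRegularCone_univ (n := 2)).uniqueDiffOn_outer

theorem uniqueDiffOn_halfExterior : UniqueDiffOn ℝ halfExterior := by
  rw [← outer_halfSpace_eq]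
  exact isRegularCone_halfSpace.uniqueDiffOn_outer

end ConformalMass

/-! ### The theorem on the manifold -/

theorem lemma3 {H : Type*} [TopologicalSpace H] {I : ModelWithCorners ℝ ConformalMass.E3 H}
    {M : Type*} [TopologicalSpace M] [ChartedSpace H M] [IsManifold I ∞ M]
    (g : ConformalMass.Metric3 I M) (f : M → ℝ) (hf : ContMDiff I 𝓘(ℝ, ℝ) ∞ f)
    (hpos : ∀ p, 0 < f p) (lam : ℝ) (hlam : lam ∈ Set.Icc (0 : ℝ) 1) :
    (∀ e : ConformalMass.EndChart I M ConformalMass.exterior,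
      ConformalMass.IsAsymptoticallyFlat e g →
      ConformalMass.IsConformalFactor e g f →
      ∃ m m' : ℝ,
        ConformalMass.HasADMMass e g m ∧
        ConformalMass.HasADMMass e (ConformalMass.conformal g f hf hpos 4) m' ∧
        ConformalMass.HasADMMass e (ConformalMass.conformal g f hf hpos (4 * lam))
          ((1 - lam) * m + lam * m')) ∧
    (∀ e : ConformalMass.EndChart I M ConformalMass.halfExterior,
      ConformalMass.IsAsymptoticallyFlatHalfSpace e g →
      ConformalMass.IsAsymptoticallyFlatHalfSpace e (ConformalMass.conformal g f hf hpos 4) →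
      ∃ m m' : ℝ,
        ConformalMass.HasHalfSpaceMass e g m ∧
        ConformalMass.HasHalfSpaceMass e (ConformalMass.conformal g f hf hpos 4) m' ∧
        ConformalMass.HasHalfSpaceMass e (ConformalMass.conformal g f hf hpos (4 * lam))
          ((1 - lam) * m + lam * m')) := by
  open ConformalMass in
  refine ⟨fun e hAF hcf => ?_, fun e hAF hAF' => ?_⟩
  · have hG := e.isSmoothMetric uniqueDiffOn_exterior g
    obtain ⟨q, hq⟩ := hAF.1.exists_decaysAtRate
    obtain ⟨⟨q', hq'1, -, hq'⟩, hΔ⟩ := hcf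
    have hF0 : DecayO exterior (-q') fun x => (f ∘ e.invFun) x - 1 := by
      refine IsBigO.trans (IsBigO.of_bound 1 (Eventually.of_forall fun x => ?_)) hq'
      rw [one_mul, Real.norm_eq_abs]
      refine le_trans ?_ (le_abs_self _)
      exact le_add_of_nonneg_right (mul_nonneg (norm_nonneg _) (Real.sqrt_nonneg _))
    have hF1 : DecayO exterior (-q') fun x =>
        ‖x‖ * gradientNorm exterior (coordMetric e g) (f ∘ e.invFun) x := by
      refine IsBigO.trans (IsBigO.of_bound 1 (Eventually.of_forall fun x => ?_)) hq'
      have h0 : 0 ≤ ‖x‖ * gradientNorm exterior (coordMetric e g) (f ∘ e.invFun) x :=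
        mul_nonneg (norm_nonneg _) (Real.sqrt_nonneg _)
      rw [one_mul, Real.norm_of_nonneg h0]
      refine le_trans ?_ (le_abs_self _)
      exact le_add_of_nonneg_left (abs_nonneg _)
    have hF : DecayingFactor exterior q' (f ∘ e.invFun) :=
      ⟨e.contDiffOn_comp hf, fun x _ => hpos _, hF0, hq.decayO_pd_of_gradientNorm hF1⟩
    -- The metric and the factor may decay at different rates; the smaller one serves both and still
    -- exceeds `1/2`.
    obtain ⟨A, B, hA, hB, hAB⟩ := (hF.mono (min_le_right q q')).exists_tendsto_massFlux hG
      (hq.mono (lt_min hq.half_lt hq'1) (min_le_left q q')) hAF.2 hΔ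
    -- The coordinate matrix of `f ^ s g` is by definition `F ^ s` times that of `g`, so the
    -- coordinate limits are the masses up to the factor `1 / (16 π)`.
    refine ⟨1 / (16 * Real.pi) * A, 1 / (16 * Real.pi) * B, hA.const_mul _, hB.const_mul _, ?_⟩
    have he : (1 - lam) * (1 / (16 * Real.pi) * A) + lam * (1 / (16 * Real.pi) * B)
        = 1 / (16 * Real.pi) * ((1 - lam) * A + lam * B) := by ring
    rw [he]
    exact (hAB lam).const_mul _
  · have hG := e.isSmoothMetric uniqueDiffOn_halfExterior g
    have hG' := e.isSmoothMetric uniqueDiffOn_halfExterior (conformal g f hf hpos 4)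
    obtain ⟨q₁, hq₁⟩ := hAF.1.exists_decaysAtRate
    obtain ⟨q₂, hq₂⟩ := hAF'.1.exists_decaysAtRate
    have hmin : 1 / 2 < min q₁ q₂ := lt_min hq₁.half_lt hq₂.half_lt
    replace hq₁ := hq₁.mono hmin (min_le_left _ _)
    replace hq₂ := hq₂.mono hmin (min_le_right _ _)
    obtain ⟨A, hA⟩ := exists_tendsto_massFlux_add_circleTerm hG hq₁ hAF.2.1 hAF.2.2
    obtain ⟨B, hB⟩ := exists_tendsto_massFlux_add_circleTerm hG' hq₂ hAF'.2.1 hAF'.2.2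
    have hF := hq₁.decayingFactor hG hq₂ (e.contDiffOn_comp hf) fun x _ => hpos _
    refine ⟨1 / (16 * Real.pi) * A, 1 / (16 * Real.pi) * B, hA.const_mul _, hB.const_mul _, ?_⟩
    have he : (1 - lam) * (1 / (16 * Real.pi) * A) + lam * (1 / (16 * Real.pi) * B)
        = 1 / (16 * Real.pi) * ((1 - lam) * A + lam * B) := by ring
    rw [he]
    exact (hF.tendsto_massFlux_add_circleTerm hG hq₁ hA hB lam).const_mul _
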